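/- For $\theta\in\mathbb{R}$ let $\mathbf{u}(\theta)=(\cos\theta,\sin\theta)$. A convex body is a bounded convex set $C\subset\mathbb{R}^2$ with non-empty interior, and $\widehat{\mathbf{1}}_C(\boldsymbol{\xi})=\int_C e^{-2\pi i\,\mathbf{x}\cdot\boldsymbol{\xi}}\,d\mathbf{x}$. For a set $I$ of angles, let $P_C(I)$ be the length (arc length along the boundary curve, that is, one-dimensional Hausdorff measure) of the set of those boundary points $\mathbf{x}\in\partial C$ for which there is $\theta\in I$ with $\mathbf{x}\cdot\mathbf{u}(\theta)=\inf_{\mathbf{a}\in C}\mathbf{a}\cdot\mathbf{u}(\theta)$. There is an absolute constant $c>0$ such that, for every convex body $C\subset\mathbb{R}^2$ and every closed interval of angles $I=[\alpha,\beta]$ with $\alpha\le\beta\le\alpha+2\pi$, the following holds. 1. If $P_C(I)+P_C(I+\pi)>0$, then $$\limsup_{\rho\to+\infty}\frac{\int_I\left|\widehat{\mathbf{1}}_C(\rho\,\mathbf{u}(\theta))\right|^2d\theta}{\rho^{-3}\left(P_C(I)+P_C(I+\pi)\right)}\le c .$$ 2. If $P_C(I)+P_C(I+\pi)=0$, then $$\lim_{\rho\to+\infty}\rho^{3}\int_I\left|\widehat{\mathbf{1}}_C(\rho\,\mathbf{u}(\theta))\right|^2d\theta=0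 .$$ -/

import Mathlib

open MeasureTheory Filter
open scoped FourierTransform RealInnerProductSpace

/-- A planar convex body: a bounded convex subset of the Euclidean plane with non-empty interior
(it need not be closed). -/
structure IsPlanarConvexBody (C : Set (EuclideanSpace ℝ (Fin 2))) : Prop where
  convex : Convex ℝ C
  bounded : Bornology.IsBounded C
  interior_nonempty : (interior C).Nonempty

/-- The unit vector `u(θ) = (cos θ, sin θ)`. -/
noncomputable def unitVec (θ : ℝ) : EuclideanSpace ℝ (Fin 2) :=
  !₂[Real.cos θ, Real.sin θ]

/-- The Fourier transform of the characteristic function of `C`, that is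
`ξ ↦ ∫ x in C, exp (-2πi x·ξ)`. -/
noncomputable def indicatorFourier (C : Set (EuclideanSpace ℝ (Fin 2))) :
    EuclideanSpace ℝ (Fin 2) → ℂ :=
  𝓕 (C.indicator fun _ => (1 : ℂ))

/-- The set of normals of `C` at a boundary point `x`: the angles `θ` at which
`inf_{a ∈ C} a·u(θ) = x·u(θ)`. It is the `2π`-periodic set of all real representatives of the
angles. (For `x` in the closure of a closed `C` the infimum is a minimum.) -/
def normalAngles (C : Set (EuclideanSpace ℝ (Fin 2))) (x : EuclideanSpace ℝ (Fin 2)) : Set ℝ :=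
  {θ | IsGLB ((fun a => ⟪a, unitVec θ⟫) '' C) ⟪x, unitVec θ⟫}

/-- The portion of perimeter of `C` with respect to a set `I` of angles: the length
(one-dimensional Hausdorff measure, which on the boundary curve of a convex body is the
arc length) of the set of the boundary points that have a normal in `I`. -/
noncomputable def perimeterPortion (C : Set (EuclideanSpace ℝ (Fin 2))) (I : Set ℝ) : ℝ :=
  (Measure.hausdorffMeasure 1 : Measure (EuclideanSpace ℝ (Fin 2))).real
    {x | x ∈ frontier C ∧ (normalAngles C x ∩ I).Nonempty}

/-- The spherical average `∫_I |1̂_C(ρ u(θ))|² dθ`. -/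
noncomputable def sphericalAverage (C : Set (EuclideanSpace ℝ (Fin 2))) (I : Set ℝ) (ρ : ℝ) : ℝ :=
  ∫ θ in I, ‖indicatorFourier C (ρ • unitVec θ)‖ ^ 2

/-- `f ≼ g` with the constant `c`: `limsup_{x → +∞} f x / g x ≤ c`. The upper limit is taken in
the extended reals, so that it is `+∞` if the quotient is unbounded. -/
def AsympLeWith (c : ℝ) (f g : ℝ → ℝ) : Prop :=
  limsup (fun x => ((f x / g x : ℝ) : EReal)) atTop ≤ (c : EReal)

/-! Fix a direction `u(θ)`. The transform at `ρ u(θ)` is the one-dimensional transform of the chord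
length function, which is midpoint concave on its support. A shift by half a period `1/(2ρ)`
reverses the sign of the exponential, so four times the transform is the transform of the negated
second difference. That difference has integral zero and can be negative only near the two ends.
Hence (`norm_indicatorFourier_le`) the transform is at most `1/(2ρ)` times the sum of the widths of
the two opposite caps of depth `d = 1/ρ`.

It remains to integrate squared cap widths over the angles. Split each width at a contact point into
two one-sided extents. If a one-sided extent is `S`, the boundary turns by at most `2d/S` while its
tangential offset reaches `S/2`; the part with offsets in `[S/4, S/2]` has length at least `S/4` and
normals in `[φ, φ + 2d/S]`. Arcs that meet belong to angles within a multiple of `d/S`. A Vitali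
selection of disjoint arcs therefore bounds the integral of `S²` by a constant times `∑ (d/S_b)
S_b²`, hence by a constant times `d` times the length swept by the arcs
(`exists_majorant_of_extent_large`). Angles with `S` at most `2d/κ` contribute only `O(d²/κ²)`.

The arcs may use normals outside the interval, by at most `κ`. Multiplying by `ρ⁻²` gives the order
`ρ⁻³` times the perimeter over the enlarged interval, with an error `O(ρ⁻⁴)` for fixed `κ`. Since
lengths of contact sets are finite and continuous from above
(`tendsto_hausdorffMeasure_contactSet`), `κ` can be chosen before `ρ → ∞` so that the enlargement
costs an arbitrary `ε`; this yields both cases. -/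

/-! ### Contact points and the geometry of middle arcs -/

section Contact

variable {E : Type*} [NormedAddCommGroup E] [InnerProductSpace ℝ E]

/-- `x` is a point of `K` at which the linear functional `⟪·, w⟫` attains its minimum over `K`. -/
def IsContact (K : Set E) (w x : E) : Prop := x ∈ K ∧ ∀ a ∈ K, ⟪x, w⟫ ≤ ⟪a, w⟫

/-- The points of `K` at which some functional `⟪·, U ψ⟫` with `ψ ∈ A` attains its minimum. -/
def contactSet (K : Set E) (U : ℝ → E) (A : Set ℝ) : Set E := {x | ∃ ψ ∈ A, IsContact K (U ψ) x}

theorem contactSet_mono (K : Set E) (U : ℝ → E) {A B : Set ℝ} (h : A ⊆ B) :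
    contactSet K U A ⊆ contactSet K U B := fun _ ⟨ψ, hψ, hx⟩ => ⟨ψ, h hψ, hx⟩

theorem exists_isContact {K : Set E} (hK : IsCompact K) (hne : K.Nonempty) (w : E) :
    ∃ x, IsContact K w x := by
  obtain ⟨x, hx, hmin⟩ := hK.exists_isMinOn hne
    (f := fun a => ⟪a, w⟫) (by fun_prop)
  exact ⟨x, hx, fun a ha => hmin ha⟩

/-- The contact relation is cut out by closed conditions in angle and point jointly. Projecting this
compact graph to either factor shows that sets of contact points, and sets of angles having a
contact point in `F`, are closed. -/
theorem isCompact_contactSet_inter {K : Set E} (hK : IsCompact K) {U : ℝ → E} (hU : Continuous U)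
    {A : Set ℝ} (hA : IsCompact A) {F : Set E} (hF : IsClosed F) :
    IsCompact {q : ℝ × E | q.1 ∈ A ∧ IsContact K (U q.1) q.2 ∧ q.2 ∈ F} := by
  have h : {q : ℝ × E | q.1 ∈ A ∧ IsContact K (U q.1) q.2 ∧ q.2 ∈ F} =
      (A ×ˢ K) ∩ ({q : ℝ × E | q.2 ∈ F} ∩
        ⋂ a ∈ K, {q : ℝ × E | ⟪q.2, U q.1⟫ ≤ ⟪a, U q.1⟫}) := by
    ext q
    simp only [IsContact, Set.mem_ofPred_eq, Set.mem_inter_iff, Set.mem_prod, Set.mem_iInter]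
    tauto
  rw [h]
  refine (hA.prod hK).inter_right ((hF.preimage continuous_snd).inter ?_)
  refine isClosed_biInter fun a _ => isClosed_le ?_ ?_ <;> fun_prop

theorem isCompact_contactSet {K : Set E} (hK : IsCompact K) {U : ℝ → E} (hU : Continuous U)
    {A : Set ℝ} (hA : IsCompact A) : IsCompact (contactSet K U A) := by
  have h := (isCompact_contactSet_inter hK hU hA isClosed_univ).image continuous_snd
  convert h using 1
  ext x
  simp [contactSet]

/-- A rotating orthonormal frame in a plane: `U` and `V` turn with unit speed, `U' = -V`. -/
structure IsMovingFrame (U V : ℝ → E) : Prop where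
  left_add : ∀ φ κ, U (φ + κ) = Real.cos κ • U φ - Real.sin κ • V φ
  right_add : ∀ φ κ, V (φ + κ) = Real.sin κ • U φ + Real.cos κ • V φ
  norm_right_le : ∀ φ, ‖V φ‖ ≤ 1

theorem IsMovingFrame.continuous_left {U V : ℝ → E} (h : IsMovingFrame U V) : Continuous U := by
  have : U = fun κ => Real.cos κ • U 0 - Real.sin κ • V 0 := by
    funext κ
    simpa using h.left_add 0 κ
  rw [this]
  fun_prop

/-- The part of the boundary of `K` whose tangential distance from `y` lies between `S / 4` and
`S / 2`, and that has a normal angle in `[φ, φ + κ]`. -/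
def middleArc (K : Set E) (U V : ℝ → E) (y : E) (S κ φ : ℝ) : Set E :=
  contactSet K U (Set.Icc φ (φ + κ)) ∩ {x | S / 4 ≤ ⟪x - y, V φ⟫ ∧ ⟪x - y, V φ⟫ ≤ S / 2}

theorem isCompact_middleArc {K : Set E} (hK : IsCompact K) {U V : ℝ → E} (hU : Continuous U)
    (y : E) (S κ φ : ℝ) : IsCompact (middleArc K U V y S κ φ) := by
  have h1 : IsClosed {x : E | S / 4 ≤ ⟪x - y, V φ⟫} := isClosed_le (by fun_prop) (by fun_prop)
  have h2 : IsClosed {x : E | ⟪x - y, V φ⟫ ≤ S / 2} := isClosed_le (by fun_prop) (by fun_prop)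
  exact (isCompact_contactSet hK hU isCompact_Icc).inter_right (h1.inter h2)

/-- A contact point in a direction turned by `κ` lies beyond half of the tangential extent `S` of
a cap of depth `d`, if `κ` is at least `2 * d / S`. -/
theorem half_le_of_isContact {K : Set E} {U V : ℝ → E} (hf : IsMovingFrame U V) {φ S κ d : ℝ}
    {y p z : E} (hy : IsContact K (U φ) y) (hpK : p ∈ K) (hpd : ⟪p - y, U φ⟫ ≤ d)
    (hS : ⟪p - y, V φ⟫ = S) (hκ : 0 < κ) (hκ1 : κ ≤ 1) (hd : 2 * d ≤ κ * S) (hS0 : 0 < S)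
    (hz : IsContact K (U (φ + κ)) z) : S / 2 ≤ ⟪z - y, V φ⟫ := by
  have h1 := hz.2 p hpK
  have h2 : ⟪z - y, U (φ + κ)⟫ ≤ ⟪p - y, U (φ + κ)⟫ := by
    simp only [inner_sub_left]; linarith
  rw [hf.left_add] at h2
  simp only [inner_sub_right, real_inner_smul_right] at h2
  rw [hS] at h2
  have h3 : 0 ≤ ⟪z - y, U φ⟫ := by
    have := hy.2 z hz.1
    simp only [inner_sub_left]; linarith
  have hpi := Real.pi_gt_three
  have hc : 0 < Real.cos κ := Real.cos_pos_of_mem_Ioo ⟨by linarith, by linarith⟩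
  have hs : 0 < Real.sin κ := Real.sin_pos_of_pos_of_lt_pi hκ (by linarith)
  -- This is `κ ≤ tan κ`. As `p` has height at most `d ≤ κ S / 2`, in the turned direction that
  -- height costs at most half of the gain `sin κ * S`.
  have ht : κ * Real.cos κ ≤ Real.sin κ := by
    have := (Real.lt_tan hκ (by linarith)).le
    rwa [Real.tan_eq_sin_div_cos, le_div_iff₀ hc] at this
  have h4 : Real.cos κ * ⟪p - y, U φ⟫ ≤ Real.sin κ * (S / 2) := by
    calc Real.cos κ * ⟪p - y, U φ⟫ ≤ Real.cos κ * (κ * S / 2) := by gcongr; linarith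
      _ = κ * Real.cos κ * (S / 2) := by ring
      _ ≤ _ := by gcongr
  have h5 : 0 ≤ Real.cos κ * ⟪z - y, U φ⟫ := by positivity
  have h6 : Real.sin κ * (S / 2) ≤ Real.sin κ * ⟪z - y, V φ⟫ := by linarith
  exact le_of_mul_le_mul_left h6 hs

/-- The contact points in one direction form a convex face, on which a linear functional takes all
intermediate values. -/
theorem isContact_exists_between {K : Set E} (hK : Convex ℝ K) {w v y x₁ x₂ : E} {s : ℝ}
    (h₁ : IsContact K w x₁) (h₂ : IsContact K w x₂) (hs₁ : ⟪x₁ - y, v⟫ ≤ s)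
    (hs₂ : s ≤ ⟪x₂ - y, v⟫) : ∃ x, IsContact K w x ∧ ⟪x - y, v⟫ = s := by
  have hconv : Convex ℝ {x | IsContact K w x} := by
    intro a ha b hb r t hr ht hrt
    refine ⟨hK ha.1 hb.1 hr ht hrt, fun c hc => ?_⟩
    have h1 := mul_le_mul_of_nonneg_left (ha.2 c hc) hr
    have h2 := mul_le_mul_of_nonneg_left (hb.2 c hc) ht
    simp only [inner_add_left, real_inner_smul_left]
    have : ⟪c, w⟫ = r * ⟪c, w⟫ + t * ⟪c, w⟫ := by rw [← add_mul, hrt, one_mul]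
    linarith
  obtain ⟨x, hx, hxs⟩ := hconv.isPreconnected.intermediate_value h₁ h₂
    (f := fun x => ⟪x - y, v⟫) (by fun_prop) ⟨hs₁, hs₂⟩
  exact ⟨x, hx, hxs⟩

/-- Every tangential distance `s ≤ S / 2` is realised by a contact point with normal angle in
`[φ, φ + κ]`. -/
theorem exists_contact_of_offset {K : Set E} (hK : IsCompact K) (hKc : Convex ℝ K)
    {U V : ℝ → E} (hf : IsMovingFrame U V) {φ S κ d : ℝ}
    {y p : E} (hy : IsContact K (U φ) y) (hpK : p ∈ K) (hpd : ⟪p - y, U φ⟫ ≤ d)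
    (hS : ⟪p - y, V φ⟫ = S) (hκ : 0 < κ) (hκ1 : κ ≤ 1) (hd : 2 * d ≤ κ * S) (hS0 : 0 < S)
    {s : ℝ} (hs0 : 0 ≤ s) (hs : s ≤ S / 2) :
    ∃ x ∈ contactSet K U (Set.Icc φ (φ + κ)), ⟪x - y, V φ⟫ = s := by
  have hclosed : ∀ F : Set E, IsClosed F →
      IsClosed {ψ | ψ ∈ Set.Icc φ (φ + κ) ∧ ∃ x, IsContact K (U ψ) x ∧ x ∈ F} := by
    intro F hF
    have h := ((isCompact_contactSet_inter hK hf.continuous_left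
      (isCompact_Icc (a := φ) (b := φ + κ)) hF).image continuous_fst).isClosed
    convert h using 1
    ext ψ
    simp
  -- The angles with a contact point of offset at most `s`, and those with one of offset at least
  -- `s`, are two closed sets covering a connected interval. At a common angle the face itself
  -- crosses offset `s`, so jumps along flat sides do no harm.
  have hpre := isPreconnected_closed_iff.1 (isPreconnected_Icc (a := φ) (b := φ + κ))
    _ _ (hclosed {x | ⟪x - y, V φ⟫ ≤ s} (isClosed_le (by fun_prop) (by fun_prop)))
    (hclosed {x | s ≤ ⟪x - y, V φ⟫} (isClosed_le (by fun_prop) (by fun_prop)))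
  obtain ⟨z, hz⟩ := exists_isContact hK ⟨y, hy.1⟩ (U (φ + κ))
  have hzs := half_le_of_isContact hf hy hpK hpd hS hκ hκ1 hd hS0 hz
  obtain ⟨ψ, hψ, ⟨-, x₁, hx₁, h₁⟩, ⟨-, x₂, hx₂, h₂⟩⟩ := hpre
    (by
      intro ψ hψ
      obtain ⟨x, hx⟩ := exists_isContact hK ⟨y, hy.1⟩ (U ψ)
      rcases le_total ⟪x - y, V φ⟫ s with h | h
      · exact Or.inl ⟨hψ, x, hx, h⟩
      · exact Or.inr ⟨hψ, x, hx, h⟩)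
    ⟨φ, ⟨le_rfl, by linarith⟩, ⟨le_rfl, by linarith⟩, y, hy, by simpa using hs0⟩
    ⟨φ + κ, ⟨by linarith, le_rfl⟩, ⟨by linarith, le_rfl⟩, z, hz, hs.trans hzs⟩
  obtain ⟨x, hx, hxs⟩ := isContact_exists_between hKc hx₁ hx₂ h₁ h₂
  exact ⟨x, ⟨ψ, hψ, hx⟩, hxs⟩

/-- A middle arc has length at least `S / 4`. -/
theorem le_hausdorffMeasure_middleArc [MeasurableSpace E] [BorelSpace E]
    {K : Set E} (hK : IsCompact K) (hKc : Convex ℝ K)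
    {U V : ℝ → E} (hf : IsMovingFrame U V) {φ S κ d : ℝ}
    {y p : E} (hy : IsContact K (U φ) y) (hpK : p ∈ K) (hpd : ⟪p - y, U φ⟫ ≤ d)
    (hS : ⟪p - y, V φ⟫ = S) (hκ : 0 < κ) (hκ1 : κ ≤ 1) (hd : 2 * d ≤ κ * S) (hS0 : 0 < S) :
    ENNReal.ofReal (S / 4) ≤ Measure.hausdorffMeasure 1 (middleArc K U V y S κ φ) := by
  -- Projection to the tangent line does not increase length, and its image of the arc covers `[S/4,
  -- S/2]`.
  have hlip : LipschitzWith 1 fun x : E => ⟪x - y, V φ⟫ := by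
    refine LipschitzWith.of_dist_le_mul fun a b => ?_
    rw [Real.dist_eq, ← inner_sub_left, NNReal.coe_one, one_mul, sub_sub_sub_cancel_right,
      dist_eq_norm]
    calc |⟪a - b, V φ⟫| ≤ ‖a - b‖ * ‖V φ‖ := abs_real_inner_le_norm _ _
      _ ≤ ‖a - b‖ * 1 := by gcongr; exact hf.norm_right_le φ
      _ = _ := mul_one _
  have himg : Set.Icc (S / 4) (S / 2) ⊆
      (fun x : E => ⟪x - y, V φ⟫) '' middleArc K U V y S κ φ := by
    rintro s ⟨hs1, hs2⟩
    obtain ⟨x, hx, hxs⟩ := exists_contact_of_offset hK hKc hf hy hpK hpd hS hκ hκ1 hd hS0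
      (s := s) (by linarith) hs2
    exact ⟨x, ⟨hx, by simpa [hxs] using ⟨hs1, hs2⟩⟩, hxs⟩
  calc ENNReal.ofReal (S / 4) = volume (Set.Icc (S / 4) (S / 2)) := by
        rw [Real.volume_Icc]; congr 1; ring
    _ ≤ volume ((fun x : E => ⟪x - y, V φ⟫) '' middleArc K U V y S κ φ) := measure_mono himg
    _ = Measure.hausdorffMeasure 1 ((fun x : E => ⟪x - y, V φ⟫) '' middleArc K U V y S κ φ) := by
        rw [hausdorffMeasure_real]
    _ ≤ _ := by
        simpa using (hlip.lipschitzOnWith (s := middleArc K U V y S κ φ)).hausdorffMeasure_image_le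
          (d := 1) zero_le_one

/-- The normal angles at a point of a middle arc, if close to `φ`, are at least `φ`. -/
theorem le_of_mem_middleArc {K : Set E} {U V : ℝ → E} (hf : IsMovingFrame U V) {φ S κ ψ : ℝ}
    {x y : E} (hy : IsContact K (U φ) y) (hS0 : 0 < S) (hx : x ∈ middleArc K U V y S κ φ)
    (hψ : IsContact K (U ψ) x) (h : φ - ψ ≤ 3 / 2) : φ ≤ ψ := by
  by_contra! hlt
  have h1 := hψ.2 y hy.1
  have h2 := hy.2 x hψ.1
  have e : U ψ = Real.cos (φ - ψ) • U φ + Real.sin (φ - ψ) • V φ := by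
    have := hf.left_add φ (ψ - φ)
    rw [add_sub_cancel, ← neg_sub φ ψ, Real.cos_neg, Real.sin_neg] at this
    rw [this, neg_smul, sub_neg_eq_add]
  have h3 : ⟪x - y, U ψ⟫ ≤ 0 := by rw [inner_sub_left]; linarith
  have h4 : 0 ≤ ⟪x - y, U φ⟫ := by rw [inner_sub_left]; linarith
  rw [e, inner_add_right, real_inner_smul_right, real_inner_smul_right] at h3
  have hpi := Real.pi_gt_three
  have hc : 0 < Real.cos (φ - ψ) := Real.cos_pos_of_mem_Ioo ⟨by linarith, by linarith⟩
  have hs : 0 < Real.sin (φ - ψ) := Real.sin_pos_of_pos_of_lt_pi (by linarith) (by linarith)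
  -- The lower cutoff `S / 4` keeps the offset strictly positive; this is what rules out a normal
  -- turned backwards.
  have h5 := hx.2.1
  have : 0 < Real.sin (φ - ψ) * ⟪x - y, V φ⟫ := mul_pos hs (by linarith)
  have : 0 ≤ Real.cos (φ - ψ) * ⟪x - y, U φ⟫ := by positivity
  linarith

/-- Two middle arcs that meet, the first not much longer than the second, belong to nearby
angles. -/
theorem abs_sub_le_of_middleArc_inter {K : Set E} {U V : ℝ → E} (hf : IsMovingFrame U V)
    {φ φ' S S' d : ℝ} {x y y' : E} (hy : IsContact K (U φ) y) (hy' : IsContact K (U φ') y')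
    (hd : 0 < d) (hS0 : 0 < S) (hS0' : 0 < S') (hκ : 2 * d / S ≤ 1 / 4) (hκ' : 2 * d / S' ≤ 1 / 4)
    (hx : x ∈ middleArc K U V y S (2 * d / S) φ)
    (hx' : x ∈ middleArc K U V y' S' (2 * d / S') φ')
    (h1 : φ - φ' ≤ 1) (h2 : φ' - φ ≤ 1) : |φ - φ'| ≤ 8 * d / S' := by
  obtain ⟨ψ, hψ, hcψ⟩ := hx.1
  obtain ⟨ψ', hψ', hcψ'⟩ := hx'.1
  have hκ0 : 0 < 2 * d / S := by positivity
  have hκ0' : 0 < 2 * d / S' := by positivity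
  have e8 : 8 * d / S' = 4 * (2 * d / S') := by ring
  rcases le_or_gt φ' φ with hle | hlt
  · have := le_of_mem_middleArc hf hy hS0 hx hcψ' (by linarith [hψ'.1])
    rw [abs_of_nonneg (by linarith), e8]
    linarith [hψ'.2]
  · have hτ := le_of_mem_middleArc hf hy' hS0' hx' hcψ (by linarith [hψ.1])
    have hτ' : φ' - φ ≤ 2 * d / S := by linarith [hψ.2]
    -- The point `x` has offset at least `S'/4` from `y'` and at most `S/2` from `y`, while `y` lies
    -- behind `y'`. Comparing the two frames loses only the factor `cos (τ + κ) ≥ 1/2`.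
    have key : S' ≤ 4 * S := by
      have hpi := Real.pi_gt_three
      set τ := φ' - φ with hτdef
      set κ := ψ' - φ' with hκdef
      have hκ4 : κ ≤ 1 / 4 := by linarith [hψ'.2]
      have hκn : 0 ≤ κ := by linarith [hψ'.1]
      have hτn : 0 < τ := by linarith
      have hcτ : 0 < Real.cos τ := Real.cos_pos_of_mem_Ioo ⟨by linarith, by linarith⟩
      have hsτ : 0 < Real.sin τ := Real.sin_pos_of_pos_of_lt_pi (by linarith) (by linarith)
      have hcκ : 0 < Real.cos κ := Real.cos_pos_of_mem_Ioo ⟨by linarith, by linarith⟩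
      have hsκ : 0 ≤ Real.sin κ := Real.sin_nonneg_of_nonneg_of_le_pi (by linarith) (by linarith)
      have hcc : 1 / 2 ≤ Real.cos (τ + κ) := by
        have := Real.one_sub_sq_div_two_le_cos (x := τ + κ)
        nlinarith
      have hU' : U φ' = Real.cos τ • U φ - Real.sin τ • V φ := by
        rw [← hf.left_add, hτdef, add_sub_cancel]
      have hV : V φ = Real.cos τ • V φ' - Real.sin τ • U φ' := by
        have := hf.right_add φ' (-τ)
        rw [hτdef, show φ' + -(φ' - φ) = φ by ring, ← hτdef, Real.cos_neg, Real.sin_neg] at this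
        rw [this, neg_smul]; abel
      have hUψ : U ψ' = Real.cos κ • U φ' - Real.sin κ • V φ' := by
        rw [← hf.left_add, hκdef, add_sub_cancel]
      -- the contact point `y` lies to the left of `y'`
      have hD : ⟪y - y', V φ⟫ ≤ 0 := by
        have a1 : ⟪y - y', U φ⟫ ≤ 0 := by rw [inner_sub_left]; linarith [hy.2 y' hy'.1]
        have a2 : 0 ≤ ⟪y - y', U φ'⟫ := by rw [inner_sub_left]; linarith [hy'.2 y hy.1]
        rw [hU', inner_sub_right, real_inner_smul_right, real_inner_smul_right] at a2
        have a3 : Real.cos τ * ⟪y - y', U φ⟫ ≤ 0 := mul_nonpos_of_nonneg_of_nonpos hcτ.le a1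
        by_contra! hcon
        have := mul_pos hsτ hcon
        linarith
      have hdepth : Real.cos κ * ⟪x - y', U φ'⟫ ≤ Real.sin κ * ⟪x - y', V φ'⟫ := by
        have a1 : ⟪x - y', U ψ'⟫ ≤ 0 := by rw [inner_sub_left]; linarith [hcψ'.2 y' hy'.1]
        rw [hUψ, inner_sub_right, real_inner_smul_right, real_inner_smul_right] at a1
        linarith
      have ho : S' / 4 ≤ ⟪x - y', V φ'⟫ := hx'.2.1
      have hoS : ⟪x - y, V φ⟫ ≤ S / 2 := hx.2.2
      have e1 : ⟪x - y, V φ⟫ = ⟪x - y', V φ⟫ - ⟪y - y', V φ⟫ := by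
        rw [← inner_sub_left, sub_sub_sub_cancel_right]
      have e2 : ⟪x - y', V φ⟫ = Real.cos τ * ⟪x - y', V φ'⟫ - Real.sin τ * ⟪x - y', U φ'⟫ := by
        rw [hV, inner_sub_right, real_inner_smul_right, real_inner_smul_right]
      have h3 : Real.cos (τ + κ) * ⟪x - y', V φ'⟫ ≤ Real.cos κ * ⟪x - y', V φ⟫ := by
        rw [Real.cos_add, e2]
        have := mul_le_mul_of_nonneg_left hdepth hsτ.le
        linarith
      have h4 : 1 / 2 * (S' / 4) ≤ Real.cos (τ + κ) * ⟪x - y', V φ'⟫ := by gcongr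
      have h5 : Real.cos κ * ⟪x - y', V φ⟫ ≤ Real.cos κ * (S / 2) := by gcongr; linarith
      have h6 : Real.cos κ * (S / 2) ≤ 1 * (S / 2) := by gcongr; exact Real.cos_le_one κ
      linarith
    rw [abs_of_neg (by linarith)]
    have : 2 * d / S ≤ 8 * d / S' := by
      rw [div_le_div_iff₀ hS0 hS0']
      nlinarith
    linarith

end Contact

/-! ### Vitali selection and integrated squared extents -/

section Covering

variable {E : Type*} [NormedAddCommGroup E] [InnerProductSpace ℝ E] [MeasurableSpace E]
  [BorelSpace E]

/-- The squared tangential extents of the caps of depth `d`, for the angles at which they are large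
compared with `d`, have a measurable majorant whose integral is at most `d` times a length. -/
theorem exists_majorant_of_extent_large {K : Set E} (hK : IsCompact K) (hKc : Convex ℝ K)
    {U V : ℝ → E} (hf : IsMovingFrame U V) {y p : ℝ → E} {T : Set ℝ} {d κ₀ α β : ℝ}
    (hd : 0 < d) (hκ₀ : 0 < κ₀) (hκ₀' : κ₀ ≤ 1 / 4) (hβ : β ≤ α + 1) (hT : T ⊆ Set.Icc α β)
    (hy : ∀ φ, IsContact K (U φ) (y φ)) (hp : ∀ φ, p φ ∈ K) (hpd : ∀ φ, ⟪p φ - y φ, U φ⟫ ≤ d)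
    (hTS : ∀ φ ∈ T, 2 * d ≤ κ₀ * ⟪p φ - y φ, V φ⟫)
    (hfin : Measure.hausdorffMeasure 1 (contactSet K U (Set.Icc α (β + κ₀))) ≠ ⊤) :
    ∃ G : ℝ → ENNReal, Measurable G ∧
      (∀ φ ∈ T, ENNReal.ofReal (⟪p φ - y φ, V φ⟫ ^ 2) ≤ G φ) ∧
      ∫⁻ φ, G φ ≤ ENNReal.ofReal (256 * d) *
        Measure.hausdorffMeasure 1 (contactSet K U (Set.Icc α (β + κ₀))) := by
  set S : ℝ → ℝ := fun φ => ⟪p φ - y φ, V φ⟫ with hSdef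
  have hS0 : ∀ φ ∈ T, 0 < S φ := fun φ hφ => by
    have h := hTS φ hφ
    by_contra! hcon
    have : κ₀ * S φ ≤ 0 := mul_nonpos_of_nonneg_of_nonpos hκ₀.le hcon
    simp only [hSdef] at this
    linarith
  have hκS : ∀ φ ∈ T, 2 * d / S φ ≤ κ₀ := fun φ hφ => (div_le_iff₀ (hS0 φ hφ)).2 (hTS φ hφ)
  set M : ℝ → Set E := fun φ => middleArc K U V (y φ) (S φ) (2 * d / S φ) φ with hMdef
  set μ : Measure E := Measure.hausdorffMeasure 1
  have hMpos : ∀ φ ∈ T, ENNReal.ofReal (S φ / 4) ≤ μ (M φ) := fun φ hφ => by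
    have h0 := hS0 φ hφ
    refine le_hausdorffMeasure_middleArc hK hKc hf (hy φ) (hp φ) (hpd φ) rfl (by positivity)
      (by linarith [hκS φ hφ]) ?_ h0
    rw [div_mul_cancel₀ _ h0.ne']
  have hMpos' : ∀ φ ∈ T, 0 < μ (M φ) := fun φ hφ =>
    (ENNReal.ofReal_pos.2 (by linarith [hS0 φ hφ])).trans_le (hMpos φ hφ)
  have hMmeas : ∀ φ, MeasurableSet (M φ) := fun φ =>
    (isCompact_middleArc hK hf.continuous_left _ _ _ _).isClosed.measurableSet
  have hMsub : ∀ φ ∈ T, M φ ⊆ contactSet K U (Set.Icc α (β + κ₀)) := fun φ hφ =>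
    Set.inter_subset_left.trans (contactSet_mono K U
      (Set.Icc_subset_Icc (hT hφ).1 (by linarith [(hT hφ).2, hκS φ hφ])))
  -- The covering takes place among the arcs in `E`, with `S` as size: each arc meets a selected one
  -- with `S φ ≤ 2 * S b`.
  obtain ⟨u, huT, hdisj, hu⟩ := Vitali.exists_disjoint_subfamily_covering_enlargement M T S 2
    one_lt_two (fun φ hφ => (hS0 φ hφ).le) (Metric.diam K)
    (fun φ _ => by
      calc S φ ≤ ‖p φ - y φ‖ * ‖V φ‖ := real_inner_le_norm _ _
        _ ≤ ‖p φ - y φ‖ * 1 := by gcongr; exact hf.norm_right_le φ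
        _ = dist (p φ) (y φ) := by rw [mul_one, dist_eq_norm]
        _ ≤ _ := Metric.dist_le_diam_of_mem hK.isBounded (hp φ) (hy φ).1)
    (fun φ hφ => nonempty_of_measure_ne_zero (hMpos' φ hφ).ne')
  have hdisj' : Pairwise (Function.onFun Disjoint fun b : u => M b) := fun a b hab =>
    hdisj a.2 b.2 (fun h => hab (Subtype.ext h))
  have hUsub : (⋃ b : u, M b) ⊆ contactSet K U (Set.Icc α (β + κ₀)) :=
    Set.iUnion_subset fun b => hMsub b (huT b.2)
  -- Disjoint sets of positive measure inside a set of finite measure are countably many.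
  have hcount : Countable u := by
    have h := Measure.countable_meas_pos_of_disjoint_of_meas_iUnion_ne_top μ
      (fun b : u => hMmeas b) hdisj' (measure_ne_top_of_subset hUsub hfin)
    have h2 : {b : u | 0 < μ (M b)} = Set.univ := Set.eq_univ_of_forall fun b => hMpos' b (huT b.2)
    rw [h2] at h
    exact Set.countable_univ_iff.1 h
  -- The points `y φ`, `p φ` are arbitrary choices, so `S` need not be measurable; this countable
  -- sum of step functions replaces it. The height `4 * S b ^ 2` comes from `S φ ≤ 2 * S b`, the
  -- half-width from the distance between angles of meeting arcs.
  refine ⟨fun φ => ∑' b : u, (Set.Icc ((b : ℝ) - 8 * d / S b) (b + 8 * d / S b)).indicator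
    (fun _ => ENNReal.ofReal (4 * S b ^ 2)) φ, ?_, ?_, ?_⟩
  · exact Measurable.tsum fun b => measurable_const.indicator measurableSet_Icc
  · intro φ hφ
    obtain ⟨b, hb, ⟨x, hx, hx'⟩, hle⟩ := hu φ hφ
    have hbT := huT hb
    have habs := abs_sub_le_of_middleArc_inter hf (hy φ) (hy b) hd (hS0 φ hφ) (hS0 b hbT)
      ((hκS φ hφ).trans hκ₀') ((hκS b hbT).trans hκ₀') hx hx'
      (by linarith [(hT hφ).2, (hT hbT).1]) (by linarith [(hT hφ).1, (hT hbT).2])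
    rw [abs_le] at habs
    refine le_trans ?_ (ENNReal.le_tsum (⟨b, hb⟩ : u))
    rw [Set.indicator_of_mem (by constructor <;> simp only <;> linarith)]
    refine ENNReal.ofReal_le_ofReal ?_
    have := hS0 φ hφ
    change S φ ^ 2 ≤ _
    nlinarith
  · rw [lintegral_tsum fun b => (measurable_const.indicator measurableSet_Icc).aemeasurable]
    calc ∑' b : u, ∫⁻ φ, (Set.Icc ((b : ℝ) - 8 * d / S b) (b + 8 * d / S b)).indicator
          (fun _ => ENNReal.ofReal (4 * S b ^ 2)) φ
        ≤ ∑' b : u, ENNReal.ofReal (256 * d) * μ (M b) := by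
          refine ENNReal.tsum_le_tsum fun b => ?_
          have h0 := hS0 b (huT b.2)
          rw [lintegral_indicator_const measurableSet_Icc, Real.volume_Icc,
            ← ENNReal.ofReal_mul (by positivity)]
          -- Width times height is `(16 d / S b) * 4 (S b)² = 256 d * (S b / 4)`, and `S b / 4` is
          -- at most the length of the arc.
          refine le_trans (le_of_eq ?_) (mul_le_mul_right (hMpos b (huT b.2)) _)
          rw [← ENNReal.ofReal_mul (by positivity)]
          congr 1
          field_simp
          ring
      _ = ENNReal.ofReal (256 * d) * μ (⋃ b : u, M b) := by
          rw [ENNReal.tsum_mul_left, measure_iUnion hdisj' fun b => hMmeas b]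
      _ ≤ _ := by gcongr

/-- The squared tangential extents of the caps of depth `d` have a measurable majorant whose
integral over an interval of angles is at most `d` times a length, up to `O(d ^ 2)`. -/
theorem exists_majorant_of_extent {K : Set E} (hK : IsCompact K) (hKc : Convex ℝ K)
    {U V : ℝ → E} (hf : IsMovingFrame U V) {y p : ℝ → E} {d κ₀ α β : ℝ}
    (hd : 0 < d) (hκ₀ : 0 < κ₀) (hκ₀' : κ₀ ≤ 1 / 4) (hβ : β ≤ α + 1)
    (hy : ∀ φ, IsContact K (U φ) (y φ)) (hp : ∀ φ, p φ ∈ K) (hpd : ∀ φ, ⟪p φ - y φ, U φ⟫ ≤ d)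
    (hS0 : ∀ φ, 0 ≤ ⟪p φ - y φ, V φ⟫)
    (hfin : Measure.hausdorffMeasure 1 (contactSet K U (Set.Icc α (β + κ₀))) ≠ ⊤) :
    ∃ G : ℝ → ENNReal, Measurable G ∧
      (∀ φ ∈ Set.Icc α β, ENNReal.ofReal (⟪p φ - y φ, V φ⟫ ^ 2) ≤ G φ) ∧
      ∫⁻ φ in Set.Icc α β, G φ ≤ ENNReal.ofReal (256 * d) *
        Measure.hausdorffMeasure 1 (contactSet K U (Set.Icc α (β + κ₀))) +
        ENNReal.ofReal ((2 * d / κ₀) ^ 2) := by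
  obtain ⟨G, hG, hle, hint⟩ := exists_majorant_of_extent_large hK hKc hf
    (T := {φ | φ ∈ Set.Icc α β ∧ 2 * d ≤ κ₀ * ⟪p φ - y φ, V φ⟫}) hd hκ₀ hκ₀' hβ
    (fun _ h => h.1) hy hp hpd (fun _ h => h.2) hfin
  refine ⟨fun φ => G φ + ENNReal.ofReal ((2 * d / κ₀) ^ 2), hG.add_const _, fun φ hφ => ?_, ?_⟩
  · rcases le_total (2 * d) (κ₀ * ⟪p φ - y φ, V φ⟫) with h | h
    · exact (hle φ ⟨hφ, h⟩).trans le_self_add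
    · refine le_trans (ENNReal.ofReal_le_ofReal ?_) le_add_self
      refine pow_le_pow_left₀ (hS0 φ) ?_ 2
      rw [le_div_iff₀ hκ₀, mul_comm]
      exact h
  · rw [lintegral_add_left hG]
    refine add_le_add ((setLIntegral_le_lintegral _ _).trans hint) ?_
    rw [setLIntegral_const, Real.volume_Icc]
    calc _ ≤ ENNReal.ofReal ((2 * d / κ₀) ^ 2) * 1 := by
          gcongr
          rw [ENNReal.ofReal_le_one]
          linarith
      _ = _ := mul_one _

end Covering

/-! ### Planar frames, lengths of contact sets, cap widths -/

section Plane

/-- The unit vector `u(θ - π/2) = (sin θ, -cos θ)`, orthogonal to `u(θ)`. -/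
noncomputable def tangentVec (θ : ℝ) : EuclideanSpace ℝ (Fin 2) :=
  !₂[Real.sin θ, -Real.cos θ]

theorem norm_unitVec (θ : ℝ) : ‖unitVec θ‖ = 1 := by
  simp [unitVec, EuclideanSpace.norm_eq, Fin.sum_univ_two]

theorem norm_tangentVec (θ : ℝ) : ‖tangentVec θ‖ = 1 := by
  simp [tangentVec, EuclideanSpace.norm_eq, Fin.sum_univ_two]

theorem unitVec_add_pi (θ : ℝ) : unitVec (θ + Real.pi) = -unitVec θ := by
  ext i; fin_cases i <;> simp [unitVec]

theorem tangentVec_add_pi (θ : ℝ) : tangentVec (θ + Real.pi) = -tangentVec θ := by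
  ext i; fin_cases i <;> simp [tangentVec]

theorem isMovingFrame_unitVec : IsMovingFrame unitVec tangentVec where
  left_add φ κ := by
    ext i; fin_cases i <;> simp [unitVec, tangentVec, Real.cos_add, Real.sin_add] <;> ring
  right_add φ κ := by
    ext i; fin_cases i <;> simp [unitVec, tangentVec, Real.cos_add, Real.sin_add] <;> ring
  norm_right_le φ := (norm_tangentVec φ).le

/-- Reversing the angle reverses the tangent, so the one-sided extent bound also applies to the
other half of a cap. -/
theorem isMovingFrame_unitVec_neg :
    IsMovingFrame (fun φ => unitVec (-φ)) (fun φ => -tangentVec (-φ)) where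
  left_add φ κ := by
    ext i; fin_cases i <;> simp [unitVec, tangentVec, Real.cos_add, Real.sin_add] <;> ring
  right_add φ κ := by
    ext i; fin_cases i <;> simp [unitVec, tangentVec, Real.cos_add, Real.sin_add] <;> ring
  norm_right_le φ := by rw [norm_neg, norm_tangentVec]

theorem contactSet_unitVec_neg (K : Set (EuclideanSpace ℝ (Fin 2))) (a b : ℝ) :
    contactSet K (fun φ => unitVec (-φ)) (Set.Icc (-b) (-a)) =
      contactSet K unitVec (Set.Icc a b) := by
  ext x
  constructor
  · rintro ⟨ψ, hψ, hx⟩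
    exact ⟨-ψ, ⟨by linarith [hψ.2], by linarith [hψ.1]⟩, hx⟩
  · rintro ⟨ψ, hψ, hx⟩
    exact ⟨-ψ, ⟨by linarith [hψ.2], by linarith [hψ.1]⟩, by simpa using hx⟩

theorem dist_unitVec_le (a b : ℝ) : ‖unitVec a - unitVec b‖ ≤ |a - b| := by
  refine abs_le_of_sq_le_sq' ?_ (abs_nonneg _) |>.2
  rw [EuclideanSpace.norm_sq_eq, Fin.sum_univ_two, sq_abs]
  simp only [unitVec, PiLp.sub_apply, Real.norm_eq_abs, sq_abs]
  have h1 := Real.one_sub_sq_div_two_le_cos (x := a - b)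
  rw [Real.cos_sub] at h1
  have h2 := Real.sin_sq_add_cos_sq a
  have h3 := Real.sin_sq_add_cos_sq b
  simp
  nlinarith

theorem exists_smul_unitVec (p : EuclideanSpace ℝ (Fin 2)) :
    ∃ θ ∈ Set.Icc (-Real.pi) Real.pi, p = ‖p‖ • unitVec θ := by
  set z : ℂ := ⟨p 0, p 1⟩ with hz
  have hn : ‖z‖ = ‖p‖ := by
    rw [EuclideanSpace.norm_eq, Fin.sum_univ_two, Complex.norm_def, Complex.normSq_apply]
    simp [hz, sq]
  refine ⟨z.arg, ⟨(Complex.neg_pi_lt_arg z).le, Complex.arg_le_pi z⟩, ?_⟩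
  ext i
  fin_cases i
  · change p 0 = ‖p‖ * Real.cos z.arg
    rw [← hn]
    exact (Complex.norm_mul_cos_arg z).symm
  · change p 1 = ‖p‖ * Real.sin z.arg
    rw [← hn]
    exact (Complex.norm_mul_sin_arg z).symm

/-- Moving outwards along a normal, every contact point reaches the circle of radius `R`. -/
theorem exists_angle_of_isContact {K : Set (EuclideanSpace ℝ (Fin 2))} {R : ℝ} (hR : 0 < R)
    (hKR : ∀ x ∈ K, ‖x‖ ≤ R) {ψ : ℝ} {x : EuclideanSpace ℝ (Fin 2)}
    (hx : IsContact K (unitVec ψ) x) :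
    ∃ θ ∈ Set.Icc (-Real.pi) Real.pi, ∃ t : ℝ, 0 ≤ t ∧ x - t • unitVec ψ = R • unitVec θ := by
  have hcont : ContinuousOn (fun t : ℝ => ‖x - t • unitVec ψ‖) (Set.Icc 0 (2 * R)) := by
    fun_prop
  obtain ⟨t, ht, htR⟩ := intermediate_value_Icc (by positivity) hcont
    (show R ∈ Set.Icc _ _ from ⟨by simpa using hKR x hx.1, by
      have h1 := norm_sub_norm_le ((2 * R) • unitVec ψ) x
      rw [norm_smul, norm_unitVec, Real.norm_of_nonneg (by positivity), norm_sub_rev] at h1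
      have := hKR x hx.1
      linarith⟩)
  obtain ⟨θ, hθ, h⟩ := exists_smul_unitVec (x - t • unitVec ψ)
  simp only at htR
  exact ⟨θ, hθ, t, ht.1, by rw [h, htR]⟩

/-- Pushing contact points outwards along their normals to a circle of radius `R` does not decrease
distances. The contact set is thus an `R`-Lipschitz image of a subset of `[-π, π]`. -/
theorem hausdorffMeasure_contactSet_ne_top {K : Set (EuclideanSpace ℝ (Fin 2))}
    (hK : Bornology.IsBounded K) (A : Set ℝ) :
    Measure.hausdorffMeasure 1 (contactSet K unitVec A) ≠ ⊤ := by
  obtain ⟨R, hR, hKR⟩ := hK.exists_pos_norm_le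
  set Q := contactSet K unitVec A
  have hex : ∀ x ∈ Q, ∃ θ ∈ Set.Icc (-Real.pi) Real.pi, ∃ ψ t : ℝ, IsContact K (unitVec ψ) x ∧ 0 ≤ t ∧
      x - t • unitVec ψ = R • unitVec θ := by
    rintro x ⟨ψ, -, hx⟩
    obtain ⟨θ, hθ, t, ht, h⟩ := exists_angle_of_isContact hR hKR hx
    exact ⟨θ, hθ, ψ, t, hx, ht, h⟩
  choose! f hf ψ t hc ht hft using hex
  have hexp : ∀ x ∈ Q, ∀ y ∈ Q, ‖x - y‖ ≤ R * |f x - f y| := by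
    intro x hx y hy
    have e1 : R • unitVec (f x) - R • unitVec (f y) =
        (x - y) - t x • unitVec (ψ x) + t y • unitVec (ψ y) := by
      rw [← hft x hx, ← hft y hy]; abel
    have h1 : ⟪x - y, unitVec (ψ x)⟫ ≤ 0 := by
      rw [inner_sub_left]; linarith [(hc x hx).2 y (hc y hy).1]
    have h2 : 0 ≤ ⟪x - y, unitVec (ψ y)⟫ := by
      rw [inner_sub_left]; linarith [(hc y hy).2 x (hc x hx).1]
    -- By the contact inequalities `h1` and `h2`, both outward displacements contribute
    -- nonnegatively to the inner product with `x - y`.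
    have h3 : ‖x - y‖ ^ 2 ≤ ⟪x - y, R • unitVec (f x) - R • unitVec (f y)⟫ := by
      rw [e1, inner_add_right, inner_sub_right, real_inner_self_eq_norm_sq,
        real_inner_smul_right, real_inner_smul_right]
      nlinarith [mul_nonneg (ht y hy) h2, mul_nonneg (ht x hx) (neg_nonneg.2 h1)]
    have h4 := h3.trans (real_inner_le_norm _ _)
    rw [← smul_sub, norm_smul, Real.norm_of_nonneg hR.le] at h4
    have h5 := mul_le_mul_of_nonneg_left (dist_unitVec_le (f x) (f y)) hR.le
    rcases (norm_nonneg (x - y)).eq_or_lt with h0 | h0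
    · rw [← h0]; positivity
    · rw [sq] at h4
      exact (le_of_mul_le_mul_left h4 h0).trans h5
  have hinj : Set.InjOn f Q := fun x hx y hy h => by
    have := hexp x hx y hy
    rw [h, sub_self, abs_zero, mul_zero] at this
    exact sub_eq_zero.1 (norm_le_zero_iff.1 this)
  have hlip : LipschitzOnWith R.toNNReal (Function.invFunOn f Q) (f '' Q) := by
    refine LipschitzOnWith.of_dist_le_mul ?_
    rintro _ ⟨x, hx, rfl⟩ _ ⟨y, hy, rfl⟩
    rw [hinj.leftInvOn_invFunOn hx, hinj.leftInvOn_invFunOn hy, dist_eq_norm, Real.dist_eq,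
      Real.coe_toNNReal _ hR.le]
    exact hexp x hx y hy
  have h := hlip.hausdorffMeasure_image_le (d := 1) zero_le_one
  rw [hinj.leftInvOn_invFunOn.image_image, hausdorffMeasure_real] at h
  refine ne_top_of_le_ne_top (ENNReal.mul_ne_top (by rw [ENNReal.rpow_one]; exact ENNReal.coe_ne_top) ?_) h
  refine measure_ne_top_of_subset (s := Set.Icc (-Real.pi) Real.pi) ?_ measure_Icc_lt_top.ne
  rintro _ ⟨x, hx, rfl⟩
  exact hf x hx

/-- The normal angles at a fixed point form a closed set, so having some arbitrarily close to `[α,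
β]` forces one inside. -/
theorem iInter_contactSet_Icc {K : Set (EuclideanSpace ℝ (Fin 2))} (α β : ℝ) :
    ⋂ κ : ℝ, ⋂ (_ : κ > 0), contactSet K unitVec (Set.Icc (α - κ) (β + κ)) =
      contactSet K unitVec (Set.Icc α β) := by
  refine Set.Subset.antisymm (fun x hx => ?_) ?_
  · simp only [Set.mem_iInter] at hx
    have hcl : IsClosed {ψ | IsContact K (unitVec ψ) x} := by
      have hU := isMovingFrame_unitVec.continuous_left
      have : {ψ | IsContact K (unitVec ψ) x} =
          {ψ | x ∈ K} ∩ ⋂ a ∈ K, {ψ | ⟪x, unitVec ψ⟫ ≤ ⟪a, unitVec ψ⟫} := by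
        ext ψ
        simp [IsContact]
      rw [this]
      refine isClosed_const.inter (isClosed_biInter fun a _ => isClosed_le ?_ ?_) <;> fun_prop
    have hD : IsCompact ({ψ | IsContact K (unitVec ψ) x} ∩ Set.Icc (α - 1) (β + 1)) :=
      isCompact_Icc.inter_left hcl
    obtain ⟨ψ₁, hψ₁, hc₁⟩ := hx 1 one_pos
    -- The function `max (α - ψ) (ψ - β)` measures how far `ψ` is outside `[α, β]`; a positive
    -- minimum would be beaten by an angle at half that distance.
    obtain ⟨ψ₀, hψ₀, hmin⟩ := hD.exists_isMinOn ⟨ψ₁, hc₁, hψ₁⟩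
      (f := fun ψ => max (α - ψ) (ψ - β)) (by fun_prop)
    by_cases h0 : max (α - ψ₀) (ψ₀ - β) ≤ 0
    · rw [max_le_iff] at h0
      exact ⟨ψ₀, ⟨by linarith, by linarith⟩, hψ₀.1⟩
    · push Not at h0
      obtain ⟨ψ, hψ, hc⟩ := hx (min 1 (max (α - ψ₀) (ψ₀ - β) / 2))
        (lt_min one_pos (by linarith))
      have hm1 := min_le_left 1 (max (α - ψ₀) (ψ₀ - β) / 2)
      have hm2 := min_le_right 1 (max (α - ψ₀) (ψ₀ - β) / 2)
      have h1 : max (α - ψ₀) (ψ₀ - β) ≤ max (α - ψ) (ψ - β) :=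
        hmin ⟨hc, by linarith [hψ.1], by linarith [hψ.2]⟩
      have h2 : max (α - ψ) (ψ - β) ≤ max (α - ψ₀) (ψ₀ - β) / 2 :=
        max_le (by linarith [hψ.1]) (by linarith [hψ.2])
      linarith
  · exact Set.subset_iInter₂ fun κ hκ => contactSet_mono K unitVec
      (Set.Icc_subset_Icc (by linarith) (by linarith))

theorem tendsto_hausdorffMeasure_contactSet {K : Set (EuclideanSpace ℝ (Fin 2))}
    (hK : IsCompact K) (α β : ℝ) :
    Tendsto (fun κ => Measure.hausdorffMeasure 1
        (contactSet K unitVec (Set.Icc (α - κ) (β + κ)))) (nhdsWithin 0 (Set.Ioi 0))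
      (nhds (Measure.hausdorffMeasure 1 (contactSet K unitVec (Set.Icc α β)))) := by
  rw [← iInter_contactSet_Icc]
  refine tendsto_measure_biInter_gt (fun κ _ => ?_) (fun i j _ hij => ?_)
    ⟨1, one_pos, hausdorffMeasure_contactSet_ne_top hK.isBounded _⟩
  · exact (isCompact_contactSet hK isMovingFrame_unitVec.continuous_left
      isCompact_Icc).isClosed.measurableSet.nullMeasurableSet
  · exact contactSet_mono K unitVec (Set.Icc_subset_Icc (by linarith) (by linarith))

/-- The point of a cap that is extremal in a tangential direction. -/
theorem exists_cap_extremal {K : Set (EuclideanSpace ℝ (Fin 2))} (hK : IsCompact K)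
    {w y : EuclideanSpace ℝ (Fin 2)} (hy : IsContact K w y) (v : EuclideanSpace ℝ (Fin 2)) {d : ℝ}
    (hd : 0 ≤ d) :
    ∃ p ∈ K, ⟪p - y, w⟫ ≤ d ∧ ∀ x ∈ K, ⟪x - y, w⟫ ≤ d → ⟪x - y, v⟫ ≤ ⟪p - y, v⟫ := by
  have hcl : IsClosed {x | ⟪x - y, w⟫ ≤ d} := isClosed_le (by fun_prop) (by fun_prop)
  obtain ⟨p, hp, hmax⟩ := (hK.inter_right hcl).exists_isMaxOn
    (f := fun x => ⟪x - y, v⟫) ⟨y, hy.1, by simpa using hd⟩ (by fun_prop)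
  exact ⟨p, hp.1, hp.2, fun x hx hxd => hmax ⟨hx, hxd⟩⟩

/-- The widths of the caps of depth `d`, squared, have a measurable majorant whose integral over an
interval of angles is at most `d` times a portion of perimeter, up to `O(d ^ 2)`. -/
theorem exists_capWidth {K : Set (EuclideanSpace ℝ (Fin 2))} (hK : IsCompact K)
    (hKc : Convex ℝ K) (hne : K.Nonempty) {d κ α β : ℝ} (hd : 0 < d) (hκ : 0 < κ)
    (hκ' : κ ≤ 1 / 4) (hβ : β ≤ α + 1) :
    ∃ (W : ℝ → ℝ) (G : ℝ → ENNReal), Measurable G ∧ (∀ θ, 0 ≤ W θ) ∧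
      (∀ θ, ∀ x ∈ K, ∀ x' ∈ K, (∀ a ∈ K, ⟪x, unitVec θ⟫ ≤ ⟪a, unitVec θ⟫ + d) →
        (∀ a ∈ K, ⟪x', unitVec θ⟫ ≤ ⟪a, unitVec θ⟫ + d) → ⟪x - x', tangentVec θ⟫ ≤ W θ) ∧
      (∀ θ ∈ Set.Icc α β, ENNReal.ofReal (W θ ^ 2) ≤ G θ) ∧
      ∫⁻ θ in Set.Icc α β, G θ ≤ ENNReal.ofReal (1024 * d) * Measure.hausdorffMeasure 1
        (contactSet K unitVec (Set.Icc (α - κ) (β + κ))) + ENNReal.ofReal (4 * (2 * d / κ) ^ 2) := by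
  choose y hy using fun θ => exists_isContact hK hne (unitVec θ)
  choose p hpK hpd hp using fun θ => exists_cap_extremal hK (hy θ) (tangentVec θ) hd.le
  choose q hqK hqd hq using fun θ => exists_cap_extremal hK (hy θ) (-tangentVec θ) hd.le
  have hp0 : ∀ θ, 0 ≤ ⟪p θ - y θ, tangentVec θ⟫ := fun θ => by
    simpa using hp θ (y θ) (hy θ).1 (by simpa using hd.le)
  have hq0 : ∀ θ, 0 ≤ ⟪q θ - y θ, -tangentVec θ⟫ := fun θ => by
    simpa using hq θ (y θ) (hy θ).1 (by simpa using hd.le)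
  have hfin : ∀ a b, Measure.hausdorffMeasure 1 (contactSet K unitVec (Set.Icc a b)) ≠ ⊤ :=
    fun a b => hausdorffMeasure_contactSet_ne_top hK.isBounded _
  have hneg : ∀ a b : ℝ, Set.Icc (-b) (-a + κ) = Set.Icc (-b) (-(a - κ)) := fun a b => by
    rw [neg_sub, neg_add_eq_sub]
  obtain ⟨G₁, hG₁, hle₁, hint₁⟩ := exists_majorant_of_extent hK hKc isMovingFrame_unitVec
    (α := α) (β := β) hd hκ hκ' hβ hy hpK hpd hp0 (hfin _ _)
  obtain ⟨G₂, hG₂, hle₂, hint₂⟩ := exists_majorant_of_extent hK hKc isMovingFrame_unitVec_neg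
    (α := -β) (β := -α) (y := fun φ => y (-φ)) (p := fun φ => q (-φ)) hd hκ hκ' (by linarith)
    (fun φ => hy _) (fun φ => hqK _) (fun φ => hqd _) (fun φ => hq0 _)
    (by rw [hneg, contactSet_unitVec_neg]; exact hfin _ _)
  rw [hneg, contactSet_unitVec_neg] at hint₂
  have hG₂' : Measurable fun θ => G₂ (-θ) := hG₂.comp measurable_neg
  have hint₂' : ∫⁻ θ in Set.Icc α β, G₂ (-θ) = ∫⁻ φ in Set.Icc (-β) (-α), G₂ φ := by
    have := (Measure.measurePreserving_neg (volume : Measure ℝ)).setLIntegral_comp_preimage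
      (s := Set.Icc (-β) (-α)) measurableSet_Icc hG₂
    rw [← this]
    simp
  set H := Measure.hausdorffMeasure 1 (contactSet K unitVec (Set.Icc (α - κ) (β + κ)))
  refine ⟨fun θ => ⟪p θ - y θ, tangentVec θ⟫ + ⟪q θ - y θ, -tangentVec θ⟫,
    fun θ => 2 * G₁ θ + 2 * G₂ (-θ), (hG₁.const_mul 2).add (hG₂'.const_mul 2),
    fun θ => add_nonneg (hp0 θ) (hq0 θ), fun θ x hx x' hx' hxd hxd' => ?_, fun θ hθ => ?_, ?_⟩
  · have h1 := hp θ x hx (by rw [inner_sub_left]; linarith [hxd _ (hy θ).1])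
    have h2 := hq θ x' hx' (by rw [inner_sub_left]; linarith [hxd' _ (hy θ).1])
    have e : ⟪x - x', tangentVec θ⟫ = ⟪x - y θ, tangentVec θ⟫ + ⟪x' - y θ, -tangentVec θ⟫ := by
      rw [inner_neg_right, ← sub_eq_add_neg, ← inner_sub_left, sub_sub_sub_cancel_right]
    rw [e]
    exact add_le_add h1 h2
  · have h1 := hle₁ θ hθ
    have h2 := hle₂ (-θ) ⟨by linarith [hθ.2], by linarith [hθ.1]⟩
    simp only [neg_neg] at h2
    calc _ ≤ ENNReal.ofReal (2 * ⟪p θ - y θ, tangentVec θ⟫ ^ 2 +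
          2 * ⟪q θ - y θ, -tangentVec θ⟫ ^ 2) := by
          refine ENNReal.ofReal_le_ofReal ?_
          nlinarith [sq_nonneg (⟪p θ - y θ, tangentVec θ⟫ - ⟪q θ - y θ, -tangentVec θ⟫)]
      _ = 2 * ENNReal.ofReal (⟪p θ - y θ, tangentVec θ⟫ ^ 2) +
          2 * ENNReal.ofReal (⟪q θ - y θ, -tangentVec θ⟫ ^ 2) := by
          rw [ENNReal.ofReal_add (by positivity) (by positivity), ENNReal.ofReal_mul zero_le_two,
            ENNReal.ofReal_mul zero_le_two, ENNReal.ofReal_ofNat]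
      _ ≤ _ := add_le_add (mul_le_mul' le_rfl h1) (mul_le_mul' le_rfl h2)
  · rw [lintegral_add_left (hG₁.const_mul 2), lintegral_const_mul _ hG₁, lintegral_const_mul _ hG₂',
      hint₂']
    have hH₁ : Measure.hausdorffMeasure 1 (contactSet K unitVec (Set.Icc α (β + κ))) ≤ H :=
      measure_mono (contactSet_mono K unitVec (Set.Icc_subset_Icc (by linarith) le_rfl))
    have hH₂ : Measure.hausdorffMeasure 1 (contactSet K unitVec (Set.Icc (α - κ) β)) ≤ H :=
      measure_mono (contactSet_mono K unitVec (Set.Icc_subset_Icc le_rfl (by linarith)))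
    calc _ ≤ 2 * (ENNReal.ofReal (256 * d) * H + ENNReal.ofReal ((2 * d / κ) ^ 2)) +
          2 * (ENNReal.ofReal (256 * d) * H + ENNReal.ofReal ((2 * d / κ) ^ 2)) := by
          refine add_le_add (mul_le_mul' le_rfl (hint₁.trans ?_))
            (mul_le_mul' le_rfl (hint₂.trans ?_))
          · exact add_le_add (mul_le_mul' le_rfl hH₁) le_rfl
          · exact add_le_add (mul_le_mul' le_rfl hH₂) le_rfl
      -- The factor `4 * 256` arises from `(a + b)² ≤ 2a² + 2b²` and the two halves of the cap.
      _ = _ := by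
          rw [show 1024 * d = 4 * (256 * d) by ring, ENNReal.ofReal_mul zero_le_four,
            ENNReal.ofReal_mul zero_le_four, ENNReal.ofReal_ofNat]
          ring

end Plane

/-! ### Fourier decay of concave functions of one variable -/

section OneDimensional

/-- The Fourier transform at frequency `ρ` of a nonnegative, midpoint concave function on `[a, b]`
is controlled by its values at distance at most `1 / ρ` from the endpoints. -/
theorem norm_integral_exp_mul_le {g : ℝ → ℝ} (hg : Integrable g) (hg0 : ∀ t, 0 ≤ g t) {a b : ℝ}
    (hga : ∀ t < a, g t = 0) (hgb : ∀ t, b < t → g t = 0) {ρ W W' : ℝ} (hρ : 0 < ρ)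
    (hconc : ∀ t η, 0 ≤ η → a ≤ t - η → t + η ≤ b → g (t - η) + g (t + η) ≤ 2 * g t)
    (hW0 : 0 ≤ W) (hW0' : 0 ≤ W') (hW : ∀ t ≤ a + 1 / ρ, g t ≤ W)
    (hW' : ∀ t, b - 1 / ρ ≤ t → g t ≤ W') :
    ‖∫ t, Complex.exp (↑(-2 * Real.pi * (ρ * t)) * Complex.I) * (g t : ℂ)‖
      ≤ (1 / ρ) / 2 * (W + W') := by
  -- Half a period of the exponential: shifting by `η` multiplies it by `-1`.
  set η := 1 / ρ / 2 with hη
  have hη0 : 0 < η := by positivity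
  have hηρ : ρ * η = 1 / 2 := by rw [hη]; field_simp
  have hd : 1 / ρ = 2 * η := by rw [hη]; ring
  set e : ℝ → ℂ := fun t => Complex.exp (↑(-2 * Real.pi * (ρ * t)) * Complex.I) with he
  have hnorm : ∀ t, ‖e t‖ = 1 := fun t => Complex.norm_exp_ofReal_mul_I _
  have he_add : ∀ t, e (t + η) = -e t := fun t => by
    simp only [he]
    have : (↑(-2 * Real.pi * (ρ * (t + η))) * Complex.I : ℂ) =
        ↑(-2 * Real.pi * (ρ * t)) * Complex.I - Real.pi * Complex.I := by
      rw [mul_add, hηρ]; push_cast; ring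
    rw [this, Complex.exp_sub, Complex.exp_pi_mul_I]
    ring
  have he_sub : ∀ t, e (t - η) = -e t := fun t => by
    rw [eq_neg_iff_add_eq_zero, ← neg_eq_iff_add_eq_zero, ← he_add, sub_add_cancel]
  have hint : ∀ f : ℝ → ℝ, Integrable f → Integrable fun t => e t * (f t : ℂ) := fun f hf => by
    refine (hf.ofReal (𝕜 := ℂ)).bdd_mul (c := 1) (Continuous.aestronglyMeasurable (by fun_prop))
      (ae_of_all _ fun t => (hnorm t).le)
  have hgp : Integrable fun t => g (t + η) := hg.comp_add_right η
  have hgm : Integrable fun t => g (t - η) := hg.comp_sub_right η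
  set J := ∫ t, e t * (g t : ℂ) with hJ
  have hJp : ∫ t, e t * (g (t + η) : ℂ) = -J := by
    rw [hJ, ← integral_neg, ← integral_sub_right_eq_self _ η]
    refine integral_congr_ae (ae_of_all _ fun t => ?_)
    simp only [he_sub, sub_add_cancel, neg_mul]
  have hJm : ∫ t, e t * (g (t - η) : ℂ) = -J := by
    rw [hJ, ← integral_neg, ← integral_add_right_eq_self _ η]
    refine integral_congr_ae (ae_of_all _ fun t => ?_)
    simp only [he_add, add_sub_cancel_right, neg_mul]
  set Δ : ℝ → ℝ := fun t => 2 * g t - g (t - η) - g (t + η) with hΔ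
  have hΔi : Integrable Δ := ((hg.const_mul 2).sub hgm).sub hgp
  have hΔJ : ∫ t, e t * (Δ t : ℂ) = 4 * J := by
    have : ∀ t, e t * (Δ t : ℂ) = 2 * (e t * (g t : ℂ)) - e t * (g (t - η) : ℂ) -
        e t * (g (t + η) : ℂ) := fun t => by simp only [hΔ]; push_cast; ring
    simp_rw [this]
    have i1 : Integrable fun t => 2 * (e t * (g t : ℂ)) - e t * (g (t - η) : ℂ) :=
      ((hint _ hg).const_mul 2).sub (hint _ hgm)
    rw [integral_sub i1 (hint _ hgp),
      integral_sub ((hint _ hg).const_mul 2) (hint _ hgm), integral_const_mul, hJp, hJm]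
    ring
  have hΔ0 : ∫ t, Δ t = 0 := by
    simp only [hΔ]
    have i1 : Integrable fun t => 2 * g t - g (t - η) := (hg.const_mul 2).sub hgm
    rw [integral_sub i1 hgp, integral_sub (hg.const_mul 2) hgm,
      integral_const_mul, integral_sub_right_eq_self, integral_add_right_eq_self]
    ring
  -- A majorant of the negative part of `Δ`: concavity gives `Δ ≥ 0` when both shifted points stay
  -- in `[a, b]`, so only the `η`-neighbourhoods of `a` and `b` matter.
  set N : ℝ → ℝ := fun t => (Set.Icc (a - η) (a + η)).indicator (fun _ => W) t +
    (Set.Icc (b - η) (b + η)).indicator (fun _ => W') t with hN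
  have hi1 : Integrable ((Set.Icc (a - η) (a + η)).indicator fun _ : ℝ => W) :=
    (integrable_indicator_iff measurableSet_Icc).2 (by simp)
  have hi2 : Integrable ((Set.Icc (b - η) (b + η)).indicator fun _ : ℝ => W') :=
    (integrable_indicator_iff measurableSet_Icc).2 (by simp)
  have hN0 : ∀ t, 0 ≤ N t := fun t =>
    add_nonneg (Set.indicator_nonneg (fun _ _ => hW0) t) (Set.indicator_nonneg (fun _ _ => hW0') t)
  have hNint : ∫ t, N t = 2 * η * (W + W') := by
    simp only [hN]
    rw [integral_add hi1 hi2, integral_indicator_const _ measurableSet_Icc,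
      integral_indicator_const _ measurableSet_Icc, Real.volume_real_Icc_of_le (by linarith),
      Real.volume_real_Icc_of_le (by linarith)]
    simp only [smul_eq_mul]
    ring
  have hΔN : ∀ t, -Δ t ≤ N t := fun t => by
    have n1 : 0 ≤ (Set.Icc (a - η) (a + η)).indicator (fun _ => W) t :=
      Set.indicator_nonneg (fun _ _ => hW0) t
    have n2 : 0 ≤ (Set.Icc (b - η) (b + η)).indicator (fun _ => W') t :=
      Set.indicator_nonneg (fun _ _ => hW0') t
    have g0 := hg0 t
    rcases lt_or_ge t (a + η) with h1 | h1
    · have z := hga (t - η) (by linarith)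
      rcases lt_or_ge t (a - η) with h2 | h2
      · have z' := hga (t + η) (by linarith)
        simp only [hΔ, hN]
        linarith
      · have := hW (t + η) (by linarith)
        simp only [hΔ, hN]
        rw [Set.indicator_of_mem (Set.mem_Icc.2 ⟨h2, h1.le⟩)]
        linarith
    · rcases lt_or_ge (b - η) t with h2 | h2
      · have z := hgb (t + η) (by linarith)
        rcases lt_or_ge (b + η) t with h3 | h3
        · have z' := hgb (t - η) (by linarith)
          simp only [hΔ, hN]
          linarith
        · have := hW' (t - η) (by linarith)
          simp only [hΔ, hN]
          rw [Set.indicator_of_mem (Set.mem_Icc.2 ⟨h2.le, h3⟩)]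
          linarith
      · have := hconc t η hη0.le (by linarith) (by linarith)
        simp only [hΔ, hN]
        linarith
  -- Pointwise `|Δ| ≤ Δ + 2N`, and `Δ` integrates to zero, so only the negative part has to be paid
  -- for.
  have h4 : 4 * ‖J‖ ≤ 2 * (2 * η * (W + W')) := by
    calc 4 * ‖J‖ = ‖∫ t, e t * (Δ t : ℂ)‖ := by rw [hΔJ, norm_mul]; norm_num
      _ ≤ ∫ t, (Δ t + 2 * N t) := by
          refine norm_integral_le_of_norm_le (hΔi.add ((hi1.add hi2).const_mul 2))
            (ae_of_all _ fun t => ?_)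
          rw [norm_mul, hnorm, one_mul, Complex.norm_real, Real.norm_eq_abs]
          exact abs_le.2 ⟨by linarith [hΔN t, hN0 t], by linarith [hN0 t]⟩
      _ = _ := by
          have i1 : Integrable fun t => 2 * N t := (hi1.add hi2).const_mul 2
          rw [integral_add hΔi i1, hΔ0, integral_const_mul, hNint]
          ring
  linarith

end OneDimensional

/-! ### Chord lengths and the cap bound for the transform -/

section Slices

/-- The point with coordinates `q` in the orthonormal basis `u(θ), v(θ)`. -/
noncomputable def framePoint (θ : ℝ) (q : ℝ × ℝ) : EuclideanSpace ℝ (Fin 2) :=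
  q.1 • unitVec θ + q.2 • tangentVec θ

theorem inner_unitVec_tangentVec (θ : ℝ) : ⟪unitVec θ, tangentVec θ⟫ = 0 := by
  simp [unitVec, tangentVec, PiLp.inner_apply, Fin.sum_univ_two]
  ring

theorem inner_framePoint_unitVec (θ : ℝ) (q : ℝ × ℝ) : ⟪framePoint θ q, unitVec θ⟫ = q.1 := by
  rw [framePoint, inner_add_left, real_inner_smul_left, real_inner_smul_left,
    real_inner_self_eq_norm_sq, norm_unitVec, real_inner_comm, inner_unitVec_tangentVec]
  ring

theorem inner_framePoint_tangentVec (θ : ℝ) (q : ℝ × ℝ) :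
    ⟪framePoint θ q, tangentVec θ⟫ = q.2 := by
  rw [framePoint, inner_add_left, real_inner_smul_left, real_inner_smul_left,
    real_inner_self_eq_norm_sq, norm_tangentVec, inner_unitVec_tangentVec]
  ring

theorem continuous_framePoint (θ : ℝ) : Continuous (framePoint θ) := by
  unfold framePoint
  fun_prop

theorem framePoint_inner (θ : ℝ) (x : EuclideanSpace ℝ (Fin 2)) :
    framePoint θ (⟪x, unitVec θ⟫, ⟪x, tangentVec θ⟫) = x := by
  have h := Real.sin_sq_add_cos_sq θ
  ext i
  fin_cases i <;> simp [framePoint, unitVec, tangentVec, PiLp.inner_apply, Fin.sum_univ_two] <;>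
    grind

/-- The isometry of the plane that carries the standard basis to `u(θ), v(θ)`. -/
noncomputable def frameIsometry (θ : ℝ) :
    EuclideanSpace ℝ (Fin 2) →ₗᵢ[ℝ] EuclideanSpace ℝ (Fin 2) where
  toFun x := framePoint θ (x 0, x 1)
  map_add' x y := by simp only [framePoint, PiLp.add_apply]; module
  map_smul' r x := by
    simp only [framePoint, PiLp.smul_apply, smul_eq_mul, RingHom.id_apply]; module
  norm_map' x := by
    have h := Real.sin_sq_add_cos_sq θ
    change ‖framePoint θ (x 0, x 1)‖ = ‖x‖
    rw [EuclideanSpace.norm_eq, EuclideanSpace.norm_eq]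
    congr 1
    simp [framePoint, unitVec, tangentVec, Fin.sum_univ_two]
    grind

theorem measurePreserving_framePoint (θ : ℝ) :
    MeasurePreserving (framePoint θ) (volume : Measure (ℝ × ℝ)) volume := by
  have h1 := (volume_preserving_finTwoArrow ℝ).symm
  have h2 := PiLp.volume_preserving_toLp (Fin 2)
  have h3 := ((frameIsometry θ).toLinearIsometryEquiv rfl).measurePreserving
  have h := h3.comp (h2.comp h1)
  exact h

/-- The intersection of `K` with the line `{x | ⟪x, u(θ)⟫ = t}`, parametrised by arc length. -/
def slice (K : Set (EuclideanSpace ℝ (Fin 2))) (θ t : ℝ) : Set ℝ := {s | framePoint θ (t, s) ∈ K}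

theorem isCompact_slice {K : Set (EuclideanSpace ℝ (Fin 2))} (hK : IsCompact K) (θ t : ℝ) :
    IsCompact (slice K θ t) := by
  have h : slice K θ t ⊆ (fun x => ⟪x, tangentVec θ⟫) '' K := fun s hs =>
    ⟨_, hs, inner_framePoint_tangentVec θ (t, s)⟩
  refine (hK.image (by fun_prop)).of_isClosed_subset ?_ h
  have := continuous_framePoint θ
  exact hK.isClosed.preimage (by fun_prop : Continuous fun s => framePoint θ (t, s))

theorem slice_convex_comb {K : Set (EuclideanSpace ℝ (Fin 2))} (hK : Convex ℝ K)
    {θ t₁ t₂ s₁ s₂ : ℝ} (h₁ : s₁ ∈ slice K θ t₁) (h₂ : s₂ ∈ slice K θ t₂) {r r' : ℝ}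
    (hr : 0 ≤ r) (hr' : 0 ≤ r') (h : r + r' = 1) :
    r * s₁ + r' * s₂ ∈ slice K θ (r * t₁ + r' * t₂) := by
  have := hK h₁ h₂ hr hr' h
  change framePoint θ _ ∈ K
  convert this using 1
  simp only [framePoint]
  module

/-- The chord lengths of a compact convex set are midpoint concave. -/
theorem volume_slice_midpoint {K : Set (EuclideanSpace ℝ (Fin 2))} (hK : IsCompact K)
    (hKc : Convex ℝ K) {θ t η : ℝ} (h₁ : (slice K θ (t - η)).Nonempty)
    (h₂ : (slice K θ (t + η)).Nonempty) :
    volume.real (slice K θ (t - η)) + volume.real (slice K θ (t + η)) ≤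
      2 * volume.real (slice K θ t) := by
  have c₁ := isCompact_slice hK θ (t - η)
  have c₂ := isCompact_slice hK θ (t + η)
  have c := isCompact_slice hK θ t
  have hle : ∀ {A : Set ℝ}, IsCompact A → A.Nonempty → volume.real A ≤ sSup A - sInf A := by
    intro A hA hne
    have hsub : A ⊆ Set.Icc (sInf A) (sSup A) := fun s hs =>
      ⟨csInf_le hA.bddBelow hs, le_csSup hA.bddAbove hs⟩
    refine (measureReal_mono hsub measure_Icc_lt_top.ne).trans_eq ?_
    exact Real.volume_real_Icc_of_le (Real.sInf_le_sSup _ hA.bddBelow hA.bddAbove)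
  -- The one-dimensional Brunn–Minkowski argument: midpoints of the lower and of the upper ends of
  -- the outer chords lie in the middle chord, which is convex.
  have hcomb : ∀ s₁ ∈ slice K θ (t - η), ∀ s₂ ∈ slice K θ (t + η),
      1 / 2 * s₁ + 1 / 2 * s₂ ∈ slice K θ t := by
    intro s₁ hs₁ s₂ hs₂
    have := slice_convex_comb hKc hs₁ hs₂ (r := 1 / 2) (r' := 1 / 2) (by norm_num) (by norm_num)
      (by norm_num)
    rwa [show 1 / 2 * (t - η) + 1 / 2 * (t + η) = t by ring] at this
  have hinf := hcomb _ (c₁.sInf_mem h₁) _ (c₂.sInf_mem h₂)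
  have hsup := hcomb _ (c₁.sSup_mem h₁) _ (c₂.sSup_mem h₂)
  have hconv : Convex ℝ (slice K θ t) := by
    intro a ha b hb r r' hr hr' h
    have := slice_convex_comb hKc ha hb hr hr' h
    rwa [← add_mul, h, one_mul] at this
  have hIcc := hconv.ordConnected.out hinf hsup
  have := measureReal_mono hIcc c.measure_lt_top.ne (μ := volume)
  rw [Real.volume_real_Icc] at this
  have h3 := (le_max_left _ _).trans this
  linarith [hle c₁ h₁, hle c₂ h₂]

theorem volume_slice_le {K : Set (EuclideanSpace ℝ (Fin 2))} {θ t W : ℝ} (hW0 : 0 ≤ W)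
    (hW : ∀ s ∈ slice K θ t, ∀ s' ∈ slice K θ t, s - s' ≤ W) :
    volume.real (slice K θ t) ≤ W := by
  refine ENNReal.toReal_le_of_le_ofReal hW0 ?_
  refine (Real.volume_le_diam _).trans ?_
  refine Metric.ediam_le fun s hs s' hs' => ?_
  rw [edist_dist, Real.dist_eq]
  exact ENNReal.ofReal_le_ofReal (abs_le.2 ⟨by linarith [hW s' hs' s hs], hW s hs s' hs'⟩)

theorem integral_mul_prod_eq {f : ℝ × ℝ → ℝ}
    (hf : Integrable f ((volume : Measure ℝ).prod (volume : Measure ℝ))) {e : ℝ → ℂ}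
    (he : Continuous e) (hn : ∀ t, ‖e t‖ ≤ 1) :
    ∫ q, e q.1 * (f q : ℂ) ∂((volume : Measure ℝ).prod (volume : Measure ℝ)) =
      ∫ t, e t * ((∫ s, f (t, s) : ℝ) : ℂ) := by
  have hint : Integrable (fun q : ℝ × ℝ => e q.1 * (f q : ℂ))
      ((volume : Measure ℝ).prod (volume : Measure ℝ)) :=
    (hf.ofReal (𝕜 := ℂ)).bdd_mul (c := 1) (he.comp continuous_fst).aestronglyMeasurable
      (ae_of_all _ fun q => hn q.1)
  rw [integral_prod _ hint]
  refine integral_congr_ae (ae_of_all _ fun t => ?_)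
  simp only
  rw [integral_const_mul, integral_complex_ofReal]

/-- The Fourier transform of a compact set in the direction `u(θ)` is the Fourier transform of its
chord lengths. -/
theorem indicatorFourier_eq_integral_slice {K : Set (EuclideanSpace ℝ (Fin 2))} (hK : IsCompact K)
    (θ ρ : ℝ) :
    Integrable (fun t => volume.real (slice K θ t)) ∧
    indicatorFourier K (ρ • unitVec θ) =
      ∫ t, Complex.exp (↑(-2 * Real.pi * (ρ * t)) * Complex.I) *
        (volume.real (slice K θ t) : ℂ) := by
  have hmp := measurePreserving_framePoint θ
  have hKm : MeasurableSet (framePoint θ ⁻¹' K) :=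
    hK.isClosed.measurableSet.preimage hmp.measurable
  have hfin : volume (framePoint θ ⁻¹' K) ≠ ⊤ := by
    rw [hmp.measure_preimage hK.isClosed.measurableSet.nullMeasurableSet]
    exact hK.measure_lt_top.ne
  have hsm : ∀ t, MeasurableSet (slice K θ t) := fun t =>
    (isCompact_slice hK θ t).isClosed.measurableSet
  have hone : Integrable ((framePoint θ ⁻¹' K).indicator fun _ => (1 : ℝ))
      ((volume : Measure ℝ).prod (volume : Measure ℝ)) :=
    (integrable_indicator_iff hKm).2 (integrableOn_const hfin)
  have hslice : ∀ t s, (framePoint θ ⁻¹' K).indicator (fun _ => (1 : ℝ)) (t, s) =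
      (slice K θ t).indicator (fun _ => (1 : ℝ)) s := fun t s => rfl
  have hslice_int : ∀ t, ∫ s, (slice K θ t).indicator (fun _ => (1 : ℝ)) s =
      volume.real (slice K θ t) := fun t => by
    rw [integral_indicator_const _ (hsm t), smul_eq_mul, mul_one]
  refine ⟨?_, ?_⟩
  · have := hone.integral_prod_left
    simpa only [hslice, hslice_int] using this
  · rw [indicatorFourier, Real.fourier_eq', ← hmp.map_eq, integral_map hmp.measurable.aemeasurable]
    · have he : ∀ q : ℝ × ℝ, Complex.exp (↑(-2 * Real.pi * ⟪framePoint θ q, ρ • unitVec θ⟫) *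
          Complex.I) • K.indicator (fun _ => (1 : ℂ)) (framePoint θ q) =
          Complex.exp (↑(-2 * Real.pi * (ρ * q.1)) * Complex.I) *
            (((framePoint θ ⁻¹' K).indicator (fun _ => (1 : ℝ)) q : ℝ) : ℂ) := fun q => by
        rw [real_inner_smul_right, inner_framePoint_unitVec, smul_eq_mul]
        congr 1
        by_cases h : framePoint θ q ∈ K
        · rw [Set.indicator_of_mem h, Set.indicator_of_mem (show q ∈ framePoint θ ⁻¹' K from h)]
          simp
        · rw [Set.indicator_of_notMem h,
            Set.indicator_of_notMem (show q ∉ framePoint θ ⁻¹' K from h)]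
          simp
      simp_rw [he]
      rw [Measure.volume_eq_prod, integral_mul_prod_eq hone
        (e := fun t => Complex.exp (↑(-2 * Real.pi * (ρ * t)) * Complex.I)) (by fun_prop)
        (fun t => (Complex.norm_exp_ofReal_mul_I _).le)]
      simp only [hslice, hslice_int]
    · have h1 : Continuous fun x : EuclideanSpace ℝ (Fin 2) =>
          Complex.exp (↑(-2 * Real.pi * ⟪x, ρ • unitVec θ⟫) * Complex.I) := by fun_prop
      exact h1.aestronglyMeasurable.smul
        (measurable_const.indicator hK.isClosed.measurableSet).aestronglyMeasurable

/-- Decay of the Fourier transform of a compact convex set: it is controlled by the widths of the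
two opposite caps of depth `1 / ρ`. -/
theorem norm_indicatorFourier_le {K : Set (EuclideanSpace ℝ (Fin 2))} (hK : IsCompact K)
    (hKc : Convex ℝ K) (hne : K.Nonempty) {θ ρ W W' : ℝ} (hρ : 0 < ρ) (hW0 : 0 ≤ W)
    (hW0' : 0 ≤ W')
    (hW : ∀ x ∈ K, ∀ x' ∈ K, (∀ a ∈ K, ⟪x, unitVec θ⟫ ≤ ⟪a, unitVec θ⟫ + 1 / ρ) →
        (∀ a ∈ K, ⟪x', unitVec θ⟫ ≤ ⟪a, unitVec θ⟫ + 1 / ρ) → ⟪x - x', tangentVec θ⟫ ≤ W)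
    (hW' : ∀ x ∈ K, ∀ x' ∈ K, (∀ a ∈ K, ⟪a, unitVec θ⟫ ≤ ⟪x, unitVec θ⟫ + 1 / ρ) →
        (∀ a ∈ K, ⟪a, unitVec θ⟫ ≤ ⟪x', unitVec θ⟫ + 1 / ρ) → ⟪x - x', tangentVec θ⟫ ≤ W') :
    ‖indicatorFourier K (ρ • unitVec θ)‖ ≤ (1 / ρ) / 2 * (W + W') := by
  obtain ⟨hint, heq⟩ := indicatorFourier_eq_integral_slice hK θ ρ
  obtain ⟨p, hp, hpmin⟩ := hK.exists_isMinOn hne (f := fun x => ⟪x, unitVec θ⟫) (by fun_prop)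
  obtain ⟨q, hq, hqmax⟩ := hK.exists_isMaxOn hne (f := fun x => ⟪x, unitVec θ⟫) (by fun_prop)
  have hmin : ∀ x ∈ K, ⟪p, unitVec θ⟫ ≤ ⟪x, unitVec θ⟫ := fun x hx => hpmin hx
  have hmax : ∀ x ∈ K, ⟪x, unitVec θ⟫ ≤ ⟪q, unitVec θ⟫ := fun x hx => hqmax hx
  have hmem : ∀ t s, s ∈ slice K θ t → ⟪p, unitVec θ⟫ ≤ t ∧ t ≤ ⟪q, unitVec θ⟫ := by
    intro t s hs
    have h1 := hmin _ hs
    have h2 := hmax _ hs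
    rw [inner_framePoint_unitVec] at h1 h2
    exact ⟨h1, h2⟩
  have hnonempty : ∀ t, ⟪p, unitVec θ⟫ ≤ t → t ≤ ⟪q, unitVec θ⟫ → (slice K θ t).Nonempty := by
    intro t h1 h2
    obtain ⟨x, hx, hxt⟩ := hKc.isPreconnected.intermediate_value hp hq
      (f := fun x => ⟪x, unitVec θ⟫) (by fun_prop) ⟨h1, h2⟩
    refine ⟨⟪x, tangentVec θ⟫, ?_⟩
    change framePoint θ _ ∈ K
    rw [← show ⟪x, unitVec θ⟫ = t from hxt, framePoint_inner]
    exact hx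
  have hempty : ∀ t, (¬ ∃ s, s ∈ slice K θ t) → volume.real (slice K θ t) = 0 := fun t h => by
    rw [Set.not_nonempty_iff_eq_empty.1 h, measureReal_empty]
  rw [heq]
  refine norm_integral_exp_mul_le (a := ⟪p, unitVec θ⟫) (b := ⟪q, unitVec θ⟫) hint
    (fun t => measureReal_nonneg) (fun t ht => hempty t ?_) (fun t ht => hempty t ?_) hρ ?_ hW0 hW0' ?_ ?_
  · rintro ⟨s, hs⟩
    linarith [(hmem t s hs).1]
  · rintro ⟨s, hs⟩
    linarith [(hmem t s hs).2]
  · intro t η hη h1 h2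
    exact volume_slice_midpoint hK hKc (hnonempty _ h1 (by linarith))
      (hnonempty _ (by linarith) h2)
  · intro t ht
    refine volume_slice_le hW0 fun s hs s' hs' => ?_
    have := hW _ hs _ hs' (fun a ha => ?_) (fun a ha => ?_)
    · rwa [inner_sub_left, inner_framePoint_tangentVec, inner_framePoint_tangentVec] at this
    all_goals
      rw [inner_framePoint_unitVec]
      linarith [hmin a ha]
  · intro t ht
    refine volume_slice_le hW0' fun s hs s' hs' => ?_
    have := hW' _ hs _ hs' (fun a ha => ?_) (fun a ha => ?_)
    · rwa [inner_sub_left, inner_framePoint_tangentVec, inner_framePoint_tangentVec] at this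
    all_goals
      rw [inner_framePoint_unitVec]
      linarith [hmax a ha]

end Slices

/-! ### From cap widths to spherical averages -/

section SphericalAverage

/-- The boundary of a convex set is Lebesgue null, so one may pass to the compact closure. -/
theorem indicatorFourier_closure {C : Set (EuclideanSpace ℝ (Fin 2))} (hC : Convex ℝ C) :
    indicatorFourier (closure C) = indicatorFourier C := by
  have hae : (closure C).indicator (fun _ => (1 : ℂ)) =ᵐ[volume] C.indicator fun _ => (1 : ℂ) := by
    filter_upwards [measure_eq_zero_iff_ae_notMem.1 (hC.addHaar_frontier volume)] with x hx
    by_cases h : x ∈ C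
    · rw [Set.indicator_of_mem h, Set.indicator_of_mem (subset_closure h)]
    · rw [Set.indicator_of_notMem h, Set.indicator_of_notMem]
      exact fun hcl => hx ⟨hcl, fun hi => h (interior_subset hi)⟩
  funext w
  rw [indicatorFourier, indicatorFourier, Real.fourier_eq', Real.fourier_eq']
  refine integral_congr_ae ?_
  filter_upwards [hae] with x hx
  rw [hx]

/-- Infima over `C` and over its closure agree, and a minimiser of a nonzero linear functional
cannot be interior. -/
theorem setOf_frontier_normalAngles_eq (C : Set (EuclideanSpace ℝ (Fin 2))) (I : Set ℝ) :
    {x | x ∈ frontier C ∧ (normalAngles C x ∩ I).Nonempty} = contactSet (closure C) unitVec I := by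
  have hcl : ∀ (r : ℝ) (w : EuclideanSpace ℝ (Fin 2)), (∀ a ∈ C, r ≤ ⟪a, w⟫) →
      ∀ a ∈ closure C, r ≤ ⟪a, w⟫ := fun r w h =>
    closure_minimal (t := {a | r ≤ ⟪a, w⟫}) h (isClosed_le (by fun_prop) (by fun_prop))
  ext x
  constructor
  · rintro ⟨hx, θ, hθ, hI⟩
    exact ⟨θ, hI, frontier_subset_closure hx, hcl _ _ fun a ha => hθ.1 (Set.mem_image_of_mem _ ha)⟩
  · rintro ⟨θ, hI, hx, hmin⟩
    refine ⟨⟨hx, fun hint => ?_⟩, θ, ⟨?_, fun b hb => ?_⟩, hI⟩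
    · obtain ⟨ε, hε, hball⟩ := Metric.isOpen_iff.1 isOpen_interior x hint
      have hmem : x - (ε / 2) • unitVec θ ∈ C := interior_subset (hball (by
        rw [Metric.mem_ball, dist_eq_norm, sub_sub_cancel_left, norm_neg, norm_smul, norm_unitVec,
          Real.norm_of_nonneg (by positivity)]
        linarith))
      have := hmin _ (subset_closure hmem)
      rw [inner_sub_left, real_inner_smul_left, real_inner_self_eq_norm_sq, norm_unitVec] at this
      linarith
    · rintro _ ⟨a, ha, rfl⟩
      exact hmin a (subset_closure ha)
    · exact hcl b (unitVec θ) (fun a ha => hb (Set.mem_image_of_mem _ ha)) x hx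

theorem perimeterPortion_eq (C : Set (EuclideanSpace ℝ (Fin 2))) (I : Set ℝ) :
    perimeterPortion C I = (Measure.hausdorffMeasure 1).real (contactSet (closure C) unitVec I) := by
  rw [perimeterPortion, setOf_frontier_normalAngles_eq]

theorem eventually_contactSet_measure_le {K : Set (EuclideanSpace ℝ (Fin 2))} (hK : IsCompact K)
    (α β : ℝ) {ε : ℝ} (hε : 0 < ε) :
    ∀ᶠ κ in nhdsWithin 0 (Set.Ioi 0),
      (Measure.hausdorffMeasure 1).real (contactSet K unitVec (Set.Icc (α - κ) (β + κ))) ≤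
        (Measure.hausdorffMeasure 1).real (contactSet K unitVec (Set.Icc α β)) + ε := by
  have h := (ENNReal.tendsto_toReal (hausdorffMeasure_contactSet_ne_top hK.isBounded
    (Set.Icc α β))).comp (tendsto_hausdorffMeasure_contactSet hK α β)
  exact h.eventually (eventually_le_nhds (lt_add_of_pos_right _ hε))

/-- A quantitative bound for the mean square of the Fourier transform over a short interval of
angles. -/
theorem lintegral_indicatorFourier_le {K : Set (EuclideanSpace ℝ (Fin 2))} (hK : IsCompact K)
    (hKc : Convex ℝ K) (hne : K.Nonempty) {ρ κ α β : ℝ} (hρ : 0 < ρ) (hκ : 0 < κ)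
    (hκ' : κ ≤ 1 / 4) (hβ : β ≤ α + 1) :
    ∫⁻ θ in Set.Icc α β, ENNReal.ofReal (‖indicatorFourier K (ρ • unitVec θ)‖ ^ 2) ≤
      ENNReal.ofReal ((1 / ρ) ^ 3 * (1024 *
        ((Measure.hausdorffMeasure 1).real (contactSet K unitVec (Set.Icc (α - κ) (β + κ))) +
          (Measure.hausdorffMeasure 1).real (contactSet K unitVec
            (Set.Icc (α + Real.pi - κ) (β + Real.pi + κ)))) + 32 / κ ^ 2 * (1 / ρ))) := by
  set d := 1 / ρ with hd
  have hd0 : 0 < d := by positivity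
  obtain ⟨W₁, G₁, hG₁, hW₁, hb₁, hle₁, hint₁⟩ := exists_capWidth hK hKc hne (α := α) (β := β)
    hd0 hκ hκ' hβ
  obtain ⟨W₂, G₂, hG₂, hW₂, hb₂, hle₂, hint₂⟩ := exists_capWidth hK hKc hne (α := α + Real.pi)
    (β := β + Real.pi) hd0 hκ hκ' (by linarith)
  have hfin : ∀ a b, Measure.hausdorffMeasure 1 (contactSet K unitVec (Set.Icc a b)) ≠ ⊤ :=
    fun a b => hausdorffMeasure_contactSet_ne_top hK.isBounded _
  have hreal : ∀ a b, Measure.hausdorffMeasure 1 (contactSet K unitVec (Set.Icc a b)) =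
      ENNReal.ofReal ((Measure.hausdorffMeasure 1).real (contactSet K unitVec (Set.Icc a b))) :=
    fun a b => (ENNReal.ofReal_toReal (hfin a b)).symm
  rw [hreal, ← ENNReal.ofReal_mul (by positivity),
    ← ENNReal.ofReal_add (by positivity) (by positivity)] at hint₁ hint₂
  set H₁ := (Measure.hausdorffMeasure 1).real (contactSet K unitVec (Set.Icc (α - κ) (β + κ)))
    with hH₁
  set H₂ := (Measure.hausdorffMeasure 1).real (contactSet K unitVec
    (Set.Icc (α + Real.pi - κ) (β + Real.pi + κ))) with hH₂
  have hH₁0 : 0 ≤ H₁ := measureReal_nonneg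
  have hH₂0 : 0 ≤ H₂ := measureReal_nonneg
  have hG₂' : Measurable fun θ => G₂ (θ + Real.pi) := hG₂.comp (measurable_add_const _)
  have hint₂' : ∫⁻ θ in Set.Icc α β, G₂ (θ + Real.pi) =
      ∫⁻ φ in Set.Icc (α + Real.pi) (β + Real.pi), G₂ φ := by
    rw [← (measurePreserving_add_right (volume : Measure ℝ) Real.pi).setLIntegral_comp_preimage
      measurableSet_Icc hG₂]
    simp
  have hpt : ∀ θ ∈ Set.Icc α β, ENNReal.ofReal (‖indicatorFourier K (ρ • unitVec θ)‖ ^ 2) ≤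
      ENNReal.ofReal (d ^ 2) * (G₁ θ + G₂ (θ + Real.pi)) := by
    intro θ hθ
    -- The far cap in direction `θ` is the near cap in direction `θ + π`, with the tangent reversed;
    -- hence `x` and `x'` are exchanged.
    have h := norm_indicatorFourier_le hK hKc hne hρ (hW₁ θ) (hW₂ (θ + Real.pi)) (hb₁ θ)
      (fun x hx x' hx' hc hc' => by
        have := hb₂ (θ + Real.pi) x' hx' x hx
        simp only [unitVec_add_pi, tangentVec_add_pi, inner_neg_right] at this
        have h2 := this (fun a ha => by linarith [hc' a ha]) (fun a ha => by linarith [hc a ha])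
        rwa [← inner_neg_left, neg_sub] at h2)
    rw [← hd] at h
    calc ENNReal.ofReal (‖indicatorFourier K (ρ • unitVec θ)‖ ^ 2)
        ≤ ENNReal.ofReal (d ^ 2 * (W₁ θ ^ 2 + W₂ (θ + Real.pi) ^ 2)) := by
          refine ENNReal.ofReal_le_ofReal ((pow_le_pow_left₀ (norm_nonneg _) h 2).trans ?_)
          rw [mul_pow, div_pow, div_mul_eq_mul_div, mul_div_assoc]
          refine mul_le_mul_of_nonneg_left ?_ (by positivity)
          nlinarith [sq_nonneg (W₁ θ - W₂ (θ + Real.pi)), sq_nonneg (W₁ θ),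
            sq_nonneg (W₂ (θ + Real.pi))]
      _ = ENNReal.ofReal (d ^ 2) * (ENNReal.ofReal (W₁ θ ^ 2) +
            ENNReal.ofReal (W₂ (θ + Real.pi) ^ 2)) := by
          rw [ENNReal.ofReal_mul (by positivity), ENNReal.ofReal_add (by positivity) (by positivity)]
      _ ≤ _ := by
          refine mul_le_mul' le_rfl (add_le_add (hle₁ θ hθ) (hle₂ _ ?_))
          exact ⟨by linarith [hθ.1], by linarith [hθ.2]⟩
  calc _ ≤ ∫⁻ θ in Set.Icc α β, ENNReal.ofReal (d ^ 2) * (G₁ θ + G₂ (θ + Real.pi)) :=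
        setLIntegral_mono' measurableSet_Icc hpt
    _ = ENNReal.ofReal (d ^ 2) * ((∫⁻ θ in Set.Icc α β, G₁ θ) +
          ∫⁻ φ in Set.Icc (α + Real.pi) (β + Real.pi), G₂ φ) := by
        have hG : Measurable fun θ => G₁ θ + G₂ (θ + Real.pi) := hG₁.add hG₂'
        rw [lintegral_const_mul _ hG, lintegral_add_left hG₁, hint₂']
    _ ≤ ENNReal.ofReal (d ^ 2) * (ENNReal.ofReal (1024 * d * H₁ + 4 * (2 * d / κ) ^ 2) +
          ENNReal.ofReal (1024 * d * H₂ + 4 * (2 * d / κ) ^ 2)) :=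
        mul_le_mul' le_rfl (add_le_add hint₁ hint₂)
    _ = _ := by
        rw [← ENNReal.ofReal_add (by positivity) (by positivity),
          ← ENNReal.ofReal_mul (by positivity)]
        congr 1
        field_simp
        ring

theorem eventually_lintegral_indicatorFourier_le {K : Set (EuclideanSpace ℝ (Fin 2))}
    (hK : IsCompact K) (hKc : Convex ℝ K) (hne : K.Nonempty) {α β : ℝ} (hβ : β ≤ α + 1) {ε : ℝ}
    (hε : 0 < ε) :
    ∀ᶠ ρ in atTop,
      ∫⁻ θ in Set.Icc α β, ENNReal.ofReal (‖indicatorFourier K (ρ • unitVec θ)‖ ^ 2) ≤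
        ENNReal.ofReal ((1 / ρ) ^ 3 * (1024 *
          ((Measure.hausdorffMeasure 1).real (contactSet K unitVec (Set.Icc α β)) +
            (Measure.hausdorffMeasure 1).real (contactSet K unitVec
              (Set.Icc (α + Real.pi) (β + Real.pi)))) + ε)) := by
  -- Two perimeter errors weighted by `1024` total `ε / 2`; the other half absorbs the term that
  -- vanishes as `ρ → ∞`.
  have hε' : 0 < ε / 4096 := by positivity
  obtain ⟨κ, ⟨h₁, h₂⟩, hκ⟩ := (((eventually_contactSet_measure_le hK α β hε').and
    (eventually_contactSet_measure_le hK (α + Real.pi) (β + Real.pi) hε')).and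
    (Ioo_mem_nhdsGT (show (0 : ℝ) < 1 / 4 by norm_num))).exists
  have hlim : Tendsto (fun ρ : ℝ => 32 / κ ^ 2 * (1 / ρ)) atTop (nhds 0) := by
    simpa using (tendsto_inv_atTop_zero (𝕜 := ℝ)).const_mul (32 / κ ^ 2)
  filter_upwards [eventually_gt_atTop 0, hlim.eventually (eventually_le_nhds (half_pos hε))]
    with ρ hρ hle
  refine (lintegral_indicatorFourier_le hK hKc hne hρ hκ.1 hκ.2.le hβ).trans
    (ENNReal.ofReal_le_ofReal (mul_le_mul_of_nonneg_left ?_ (by positivity)))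
  linarith

theorem setLIntegral_Icc_le_of_pieces (f : ℝ → ENNReal) {α L : ℝ} {B : ENNReal} (n : ℕ)
    (h : ∀ j < n, ∫⁻ θ in Set.Icc (α + j * L) (α + j * L + L), f θ ≤ B) :
    ∫⁻ θ in Set.Icc α (α + n * L), f θ ≤ n * B := by
  induction n with
  | zero => simp
  | succ n ih =>
    have hsub : Set.Icc α (α + (n + 1 : ℕ) * L) ⊆
        Set.Icc α (α + n * L) ∪ Set.Icc (α + n * L) (α + n * L + L) := by
      rw [show α + ((n + 1 : ℕ) : ℝ) * L = α + n * L + L by push_cast; ring]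
      exact Set.Icc_subset_Icc_union_Icc
    calc _ ≤ ∫⁻ θ in Set.Icc α (α + n * L) ∪ Set.Icc (α + n * L) (α + n * L + L), f θ :=
          lintegral_mono_set hsub
      _ ≤ _ := lintegral_union_le _ _ _
      _ ≤ n * B + B := add_le_add (ih fun j hj => h j (by omega)) (h n (by omega))
      _ = _ := by push_cast; ring

/-- The mean square of the Fourier transform of a convex body over an interval of angles is
asymptotically controlled by the corresponding portions of perimeter. -/
theorem eventually_sphericalAverage_le {C : Set (EuclideanSpace ℝ (Fin 2))}
    (hC : IsPlanarConvexBody C) {α β : ℝ} (hαβ : α ≤ β) (hβ : β ≤ α + 2 * Real.pi) {ε : ℝ}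
    (hε : 0 < ε) :
    ∀ᶠ ρ in atTop, sphericalAverage C (Set.Icc α β) ρ ≤ 7 * ((1 / ρ) ^ 3 *
      (1024 * (perimeterPortion C (Set.Icc α β) +
        perimeterPortion C (Set.Icc (α + Real.pi) (β + Real.pi))) + ε)) := by
  set K := closure C with hKdef
  have hK : IsCompact K := hC.bounded.isCompact_closure
  have hKc : Convex ℝ K := hC.convex.closure
  have hne : K.Nonempty := (hC.interior_nonempty.mono interior_subset).closure
  -- Since `2π < 7`, seven pieces have length at most `1`, as the covering argument requires. Each
  -- piece is bounded by the full perimeter portions, which costs the factor `7`.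
  set L := (β - α) / 7 with hL
  have hpi : Real.pi < 3.15 := Real.pi_lt_d2
  have hL0 : 0 ≤ L := div_nonneg (by linarith) (by norm_num)
  have hL1 : L ≤ 1 := by rw [hL, div_le_one (by norm_num)]; linarith
  have hβL : β = α + (7 : ℕ) * L := by rw [hL]; push_cast; ring
  have hpieces := (Finset.range 7).eventually_all.2 fun j _ =>
    eventually_lintegral_indicatorFourier_le hK hKc hne (α := α + j * L) (β := α + j * L + L)
      (by linarith) hε
  filter_upwards [hpieces, eventually_gt_atTop 0] with ρ hρ hρ0
  rw [perimeterPortion_eq, perimeterPortion_eq, sphericalAverage,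
    ← indicatorFourier_closure hC.convex]
  have hmono : ∀ {a b a' b' : ℝ}, a' ≤ a → b ≤ b' →
      (Measure.hausdorffMeasure 1).real (contactSet K unitVec (Set.Icc a b)) ≤
        (Measure.hausdorffMeasure 1).real (contactSet K unitVec (Set.Icc a' b')) := fun h h' =>
    measureReal_mono (contactSet_mono K unitVec (Set.Icc_subset_Icc h h'))
      (hausdorffMeasure_contactSet_ne_top hK.isBounded _)
  set H := (Measure.hausdorffMeasure 1).real (contactSet K unitVec (Set.Icc α β))
  set H' := (Measure.hausdorffMeasure 1).real
    (contactSet K unitVec (Set.Icc (α + Real.pi) (β + Real.pi)))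
  have hH : 0 ≤ H := measureReal_nonneg
  have hH' : 0 ≤ H' := measureReal_nonneg
  have hle := setLIntegral_Icc_le_of_pieces
    (fun θ => ENNReal.ofReal (‖indicatorFourier K (ρ • unitVec θ)‖ ^ 2)) (α := α) (L := L)
    (B := ENNReal.ofReal ((1 / ρ) ^ 3 * (1024 * (H + H') + ε))) 7 fun j hj => by
      refine (hρ j (Finset.mem_range.2 hj)).trans (ENNReal.ofReal_le_ofReal ?_)
      have hj0 : (0 : ℝ) ≤ j * L := by positivity
      have hj7 : (j : ℝ) * L + L ≤ 7 * L := by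
        have : (j : ℝ) + 1 ≤ 7 := by exact_mod_cast hj
        nlinarith
      push_cast at hβL
      gcongr
      · exact hmono (by linarith) (by linarith)
      · exact hmono (by linarith) (by linarith)
  rw [← hβL] at hle
  -- Passing through the lower Lebesgue integral avoids any integrability requirement on the
  -- transform.
  refine (Real.le_norm_self _).trans ((norm_integral_le_lintegral_norm _).trans ?_)
  refine ENNReal.toReal_le_of_le_ofReal (by positivity) ?_
  rw [ENNReal.ofReal_mul (by norm_num), ENNReal.ofReal_ofNat]
  simpa only [norm_pow, norm_norm, Nat.cast_ofNat] using hle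

end SphericalAverage

theorem lemma3p4 :
    ∃ c : ℝ, 0 < c ∧
      ∀ C : Set (EuclideanSpace ℝ (Fin 2)), IsPlanarConvexBody C →
      ∀ α β : ℝ, α ≤ β → β ≤ α + 2 * Real.pi →
        (0 < perimeterPortion C (Set.Icc α β)
              + perimeterPortion C (Set.Icc (α + Real.pi) (β + Real.pi)) →
          AsympLeWith c (fun ρ => sphericalAverage C (Set.Icc α β) ρ)
            (fun ρ => ρ ^ (-3 : ℤ) * (perimeterPortion C (Set.Icc α β)
              + perimeterPortion C (Set.Icc (α + Real.pi) (β + Real.pi))))) ∧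
        (perimeterPortion C (Set.Icc α β)
              + perimeterPortion C (Set.Icc (α + Real.pi) (β + Real.pi)) = 0 →
          Tendsto (fun ρ : ℝ => ρ ^ 3 * sphericalAverage C (Set.Icc α β) ρ) atTop (nhds 0)) := by
  -- `7175 = 7 * (1024 + 1)`: when the total perimeter portion is positive, it is itself taken as
  -- `ε`.
  refine ⟨7175, by norm_num, fun C hC α β hαβ hβ => ⟨fun hP => ?_, fun hP => ?_⟩⟩
  · refine limsup_le_of_le (by isBoundedDefault) ?_
    filter_upwards [eventually_sphericalAverage_le hC hαβ hβ hP, eventually_gt_atTop 0]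
      with ρ hρ hρ0
    rw [EReal.coe_le_coe_iff, div_le_iff₀ (by positivity)]
    refine hρ.trans_eq ?_
    rw [zpow_neg, one_div, inv_pow]
    norm_cast
    ring
  · rw [Metric.tendsto_nhds]
    intro ε hε
    filter_upwards [eventually_sphericalAverage_le hC hαβ hβ (show 0 < ε / 14 by positivity),
      eventually_gt_atTop 0] with ρ hρ hρ0
    have h0 : 0 ≤ sphericalAverage C (Set.Icc α β) ρ := integral_nonneg fun θ => by positivity
    rw [hP, mul_zero, zero_add] at hρ
    rw [Real.dist_eq, sub_zero, abs_of_nonneg (by positivity)]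
    calc _ ≤ ρ ^ 3 * (7 * ((1 / ρ) ^ 3 * (ε / 14))) := by gcongr
      _ = ε / 2 := by field_simp; norm_num
      _ < ε := half_lt_self hε
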